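/- Let $(M^n,g)$ be a (nonempty, Hausdorff, second countable) smooth $n$-dimensional Riemannian manifold without boundary, with Levi-Civita gradient $\nabla$, Laplace operator $\Delta$ and volume element $dv_g$. Let $u\in C^\infty(M)$, $V=e^{u}$, $\lambda,\mu\in\mathbb{R}$ and $\tau=(n+1)\lambda+\mu$. For the affine connection $D=D^{\lambda,\mu}$, $D_XY=\nabla_XY+\lambda\,du(X)Y+\lambda\,du(Y)X+\mu\,g(X,Y)\nabla u$, the affine gradient and the affine Laplacian are $$\nabla^{D}f=V^{\mu-\lambda}\nabla f,\qquad \Delta^{D}f=V^{\mu-\lambda}\big[\Delta f+(2\mu+n\lambda)\langle\nabla u,\nabla f\rangle\big].$$ Let $\alpha\in\mathbb{R}$ and $C>1$ with $C+\alpha-1>0$, and let $\rho$ be a nonnegative continuous function on $M$ such that, in the sense of distributions, $|\nabla^{D}\rho|=1$ on $M$ and $\Delta^{D}\rho\ge\frac{C}{\rho}V^{\lambda-\mu}$ on $M\setminus\rho^{-1}\{0\}$. That is, $\rho$ has a locally integrable weak gradient $\nabla\rho$ with $|V^{\mu-\lambda}\nabla\rho|=1$ almost everywhere, and for every nonnegative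 $\psi\in C_0^\infty(M\setminus\rho^{-1}\{0\})$ $$-\int_M\langle\nabla\rho,\nabla(V^{\mu-\lambda}\psi)\rangle\,dv_g+(2\mu+n\lambda)\int_M\langle\nabla u,\nabla\rho\rangle V^{\mu-\lambda}\psi\,dv_g\ \ge\ \int_M\frac{C}{\rho}V^{\lambda-\mu}\psi\,dv_g .$$ Then for every $\phi\in C_0^\infty(M\setminus\rho^{-1}\{0\})$ $$\int_M\rho^{\alpha}|\nabla^{D}\phi|^{2}V^{\tau+\lambda-\mu}\,dv_g\ \ge\ (C+\alpha-1)(C+\alpha+1)\int_M\rho^{\alpha}\frac{|\phi|^{2}}{(1+\rho^{2})^{2}}V^{\tau+\lambda-\mu}\,dv_g .$$ -/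

import Mathlib

open scoped Manifold ContDiff Bundle
open MeasureTheory Bundle

noncomputable section

namespace AffineHardy

/-- The vector at `e.symm y` with constant coordinates `v` in the chart `e`. -/
def chartVector {n : ℕ} {M : Type*} [TopologicalSpace M]
    [ChartedSpace (EuclideanSpace ℝ (Fin n)) M]
    (e : OpenPartialHomeomorph M (EuclideanSpace ℝ (Fin n)))
    (y : EuclideanSpace ℝ (Fin n)) (v : EuclideanSpace ℝ (Fin n)) :
    TangentSpace (𝓡 n) (e.symm y) :=
  mfderiv (𝓡 n) (𝓡 n) e.symm y v

/-- The matrix `g_ij` of the metric in the chart `e`. -/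
def metricMatrix {n : ℕ} {M : Type*} [TopologicalSpace M]
    [ChartedSpace (EuclideanSpace ℝ (Fin n)) M]
    [RiemannianBundle (fun x : M => TangentSpace (𝓡 n) x)]
    (e : OpenPartialHomeomorph M (EuclideanSpace ℝ (Fin n)))
    (y : EuclideanSpace ℝ (Fin n)) : Matrix (Fin n) (Fin n) ℝ :=
  Matrix.of fun i j =>
    inner ℝ (chartVector e y (EuclideanSpace.single i 1))
      (chartVector e y (EuclideanSpace.single j 1))

/-- The measure `√(det g_ij) dy` on the domain of the chart `e`, extended by zero to `M`. -/
def chartVolume {n : ℕ} {M : Type*} [TopologicalSpace M]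
    [ChartedSpace (EuclideanSpace ℝ (Fin n)) M]
    [RiemannianBundle (fun x : M => TangentSpace (𝓡 n) x)] [MeasurableSpace M]
    (e : OpenPartialHomeomorph M (EuclideanSpace ℝ (Fin n))) : Measure M :=
  Measure.map e.symm
    (((volume : Measure (EuclideanSpace ℝ (Fin n))).restrict e.target).withDensity
      fun y => ENNReal.ofReal (Real.sqrt (metricMatrix e y).det))

theorem exists_chart_cover (n : ℕ) (M : Type*) [TopologicalSpace M]
    [ChartedSpace (EuclideanSpace ℝ (Fin n)) M] [SecondCountableTopology M] [Nonempty M] :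
    ∃ c : ℕ → M, ⋃ i, (chartAt (EuclideanSpace ℝ (Fin n)) (c i)).source = Set.univ := by
  obtain ⟨s, hs, hU⟩ := TopologicalSpace.countable_cover_nhds
    (f := fun x : M => (chartAt (EuclideanSpace ℝ (Fin n)) x).source)
    (fun x => chart_source_mem_nhds _ x)
  have hne : s.Nonempty := by
    obtain ⟨x⟩ := ‹Nonempty M›
    have hx : x ∈ ⋃ y ∈ s, (chartAt (EuclideanSpace ℝ (Fin n)) y).source := by
      rw [hU]; trivial
    simp only [Set.mem_iUnion] at hx
    exact ⟨hx.choose, hx.choose_spec.choose⟩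
  obtain ⟨c, rfl⟩ := hs.exists_eq_range hne
  exact ⟨c, by simpa using hU⟩

/-- Centres of a sequence of charts whose domains cover `M`. -/
def chartCenter (n : ℕ) (M : Type*) [TopologicalSpace M]
    [ChartedSpace (EuclideanSpace ℝ (Fin n)) M] [SecondCountableTopology M] [Nonempty M] :
    ℕ → M :=
  (exists_chart_cover n M).choose

/-- The Riemannian volume measure `dv_g`: the chart measures `√(det g_ij) dy` glued along the
measurable partition of `M` that a countable cover by chart domains gives. As the chart measures
agree on overlaps, the result does not depend on the cover. -/
def riemannianVolume (n : ℕ) (M : Type*) [TopologicalSpace M]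
    [ChartedSpace (EuclideanSpace ℝ (Fin n)) M] [SecondCountableTopology M] [Nonempty M]
    [RiemannianBundle (fun x : M => TangentSpace (𝓡 n) x)] [MeasurableSpace M] : Measure M :=
  Measure.sum fun i : ℕ =>
    (chartVolume (chartAt (EuclideanSpace ℝ (Fin n)) (chartCenter n M i))).restrict
      (disjointed (fun j => (chartAt (EuclideanSpace ℝ (Fin n)) (chartCenter n M j)).source) i)

/-- Tangent spaces are complete for the norm given by the Riemannian metric. -/
theorem completeSpace_tangentSpace {n : ℕ} {M : Type*} [TopologicalSpace M]
    [ChartedSpace (EuclideanSpace ℝ (Fin n)) M]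
    [RiemannianBundle (fun x : M => TangentSpace (𝓡 n) x)] (x : M) :
    CompleteSpace (TangentSpace (𝓡 n) x) := by
  have : FiniteDimensional ℝ (TangentSpace (𝓡 n) x) :=
    inferInstanceAs (FiniteDimensional ℝ (EuclideanSpace ℝ (Fin n)))
  exact FiniteDimensional.complete ℝ _

/-- The Riemannian gradient `∇f` of a differentiable function: `⟨∇f, w⟩ = df(w)`. -/
def grad {n : ℕ} {M : Type*} [TopologicalSpace M] [ChartedSpace (EuclideanSpace ℝ (Fin n)) M]
    [RiemannianBundle (fun x : M => TangentSpace (𝓡 n) x)] (f : M → ℝ) (x : M) :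
    TangentSpace (𝓡 n) x :=
  haveI := completeSpace_tangentSpace (n := n) x
  (InnerProductSpace.toDual ℝ (TangentSpace (𝓡 n) x)).symm (mvfderiv (𝓡 n) f x)

/-- The vector field `G` is the distributional gradient `∇f` of `f`: in every chart the function
`⟨G, ∂_v⟩` is locally integrable and is the weak derivative of `f` in the direction `v`. -/
structure IsWeakGradient {n : ℕ} {M : Type*} [TopologicalSpace M]
    [ChartedSpace (EuclideanSpace ℝ (Fin n)) M]
    [RiemannianBundle (fun x : M => TangentSpace (𝓡 n) x)]
    (f : M → ℝ) (G : ∀ x : M, TangentSpace (𝓡 n) x) : Prop where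
  locallyIntegrableOn_fun : ∀ p : M,
    LocallyIntegrableOn (fun y => f ((chartAt (EuclideanSpace ℝ (Fin n)) p).symm y))
      (chartAt (EuclideanSpace ℝ (Fin n)) p).target volume
  locallyIntegrableOn_grad : ∀ (p : M) (v : EuclideanSpace ℝ (Fin n)),
    LocallyIntegrableOn
      (fun y => inner ℝ (G ((chartAt (EuclideanSpace ℝ (Fin n)) p).symm y))
        (chartVector (chartAt (EuclideanSpace ℝ (Fin n)) p) y v))
      (chartAt (EuclideanSpace ℝ (Fin n)) p).target volume
  integral_eq : ∀ (p : M) (v : EuclideanSpace ℝ (Fin n)) (η : EuclideanSpace ℝ (Fin n) → ℝ),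
    ContDiff ℝ ∞ η → HasCompactSupport η →
    tsupport η ⊆ (chartAt (EuclideanSpace ℝ (Fin n)) p).target →
    ∫ y in (chartAt (EuclideanSpace ℝ (Fin n)) p).target,
        f ((chartAt (EuclideanSpace ℝ (Fin n)) p).symm y) * fderiv ℝ η y v =
      -∫ y in (chartAt (EuclideanSpace ℝ (Fin n)) p).target,
        inner ℝ (G ((chartAt (EuclideanSpace ℝ (Fin n)) p).symm y))
          (chartVector (chartAt (EuclideanSpace ℝ (Fin n)) p) y v) * η y

/-- The affine gradient `∇^D f = V^(μ-λ) ∇f`, where `V = e^u` and `G` is the (classical or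
distributional) gradient `∇f`. -/
def affineGrad {n : ℕ} {M : Type*} [TopologicalSpace M]
    [ChartedSpace (EuclideanSpace ℝ (Fin n)) M]
    (u : M → ℝ) (lam mu : ℝ) (G : ∀ x : M, TangentSpace (𝓡 n) x) (x : M) :
    TangentSpace (𝓡 n) x :=
  (Real.exp (u x) ^ (mu - lam)) • G x

/-- The distribution `Δf`, for `f` with distributional gradient `G`, at the test function `ψ`:
`⟨Δf, ψ⟩ = -∫ ⟨∇f, ∇ψ⟩ dv_g`. -/
def laplacianDistrib {n : ℕ} {M : Type*} [TopologicalSpace M]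
    [ChartedSpace (EuclideanSpace ℝ (Fin n)) M] [SecondCountableTopology M] [Nonempty M]
    [RiemannianBundle (fun x : M => TangentSpace (𝓡 n) x)] [MeasurableSpace M]
    (G : ∀ x : M, TangentSpace (𝓡 n) x) (ψ : M → ℝ) : ℝ :=
  -∫ x, inner ℝ (G x) (grad ψ x) ∂(riemannianVolume n M)

/-- The distribution `Δ^D f = V^(μ-λ) [Δf + (2μ + nλ) ⟨∇u, ∇f⟩]`, for `f` with distributional
gradient `G` and `V = e^u`, at the test function `ψ`. -/
def affineLaplacianDistrib {n : ℕ} {M : Type*} [TopologicalSpace M]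
    [ChartedSpace (EuclideanSpace ℝ (Fin n)) M] [SecondCountableTopology M] [Nonempty M]
    [RiemannianBundle (fun x : M => TangentSpace (𝓡 n) x)] [MeasurableSpace M]
    (u : M → ℝ) (lam mu : ℝ) (G : ∀ x : M, TangentSpace (𝓡 n) x) (ψ : M → ℝ) : ℝ :=
  laplacianDistrib G (fun x => Real.exp (u x) ^ (mu - lam) * ψ x) +
    ∫ x, (2 * mu + n * lam) * inner ℝ (grad u x) (G x) * (Real.exp (u x) ^ (mu - lam) * ψ x)
      ∂(riemannianVolume n M)

end AffineHardy

end

noncomputable section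

namespace AffineHardy

/-! ### Tangent vectors, gradients and the metric in chart coordinates -/

section Charts

variable {n : ℕ} {M : Type*} [TopologicalSpace M] [ChartedSpace (EuclideanSpace ℝ (Fin n)) M]

local notation "𝔼" => EuclideanSpace ℝ (Fin n)

/-! Put `a = μ - λ`, `b = 2μ + nλ`, `w = V^b` and `P = V^(b - 2a)`; then `P` is the weight
`V^(τ+λ-μ)` of the statement. Since `V^a |∇ρ| = 1`, `w |∇ρ|² = P`, and also `|∇^D φ|² P = w |∇φ|²`.
Testing the affine Laplacian inequality with `V^(b-a) η` absorbs the drift term into the weight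
(`affineLaplacianDistrib_exp_mul`) and leaves the divergence form `div (w ∇ρ) ≥ (C/ρ) P`.

Take `η = F(ρ) φ²` with `F(t) = t^α h(t)`, `h(t) = κ t / (1 + t²)`, `κ = C + α - 1`. Young's
inequality gives `-2 F φ ⟨∇ρ, ∇φ⟩ ≤ ρ^α |∇φ|² + ρ^α h² φ² |∇ρ|²` (`two_mul_hardyWeight_mul_le`),
hence `∫ (C F/ρ + F' - ρ^α h²) φ² P ≤ ∫ ρ^α w |∇φ|²`. The bracket is exactly `κ (C + α + 1) ρ^α / (1
+ ρ²)²` (`hardyWeight_riccati`). The choice of `h` comes from the model function `(1 + ρ²)^(-κ/2)`,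
whose logarithmic derivative in `ρ` is `-h`: it gives equality in Young's inequality.

The analytic difficulty is that `F(ρ) φ²` need not be smooth, as `ρ` has only a weak gradient. But
`|∇ρ|` agrees almost everywhere with a continuous function, so in a chart mollification yields
smooth `R_j → ρ` with bounded derivatives that converge almost everywhere
(`exists_smooth_approximation_chart`). Testing with `F(R_j) ψ` and dominated convergence give the
inequality for test functions supported in a chart, and a partition of unity gives it in general
(`laplacian_inequality_comp`). Passing between charts and `M` relies on the chart measures agreeing
on overlaps (`riemannianVolume_restrict_source`). -/

theorem mdifferentiableAt_chartAt_symm [IsManifold (𝓡 n) ∞ M] (p : M) {y : 𝔼}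
    (hy : y ∈ (chartAt 𝔼 p).target) :
    MDifferentiableAt (𝓡 n) (𝓡 n) (chartAt 𝔼 p).symm y :=
  mdifferentiableAt_atlas_symm (chart_mem_atlas 𝔼 p) hy

theorem mvfderiv_chartVector [IsManifold (𝓡 n) ∞ M] (p : M) {y : 𝔼}
    (hy : y ∈ (chartAt 𝔼 p).target) {f : M → ℝ}
    (hf : MDifferentiableAt (𝓡 n) 𝓘(ℝ, ℝ) f ((chartAt 𝔼 p).symm y)) (v : 𝔼) :
    mvfderiv (𝓡 n) f ((chartAt 𝔼 p).symm y) (chartVector (chartAt 𝔼 p) y v) =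
      fderiv ℝ (fun z => f ((chartAt 𝔼 p).symm z)) y v := by
  have h := mvfderiv_comp_apply (g := f) y hf (mdifferentiableAt_chartAt_symm p hy) v
  have h2 : mvfderiv (𝓡 n) (f ∘ (chartAt 𝔼 p).symm) y v =
      fderiv ℝ (fun z => f ((chartAt 𝔼 p).symm z)) y v := by
    rw [mvfderiv, mfderiv_eq_fderiv]; rfl
  rw [← h2, h]; rfl

theorem chartVector_bijective [IsManifold (𝓡 n) ∞ M] (p : M) {y : 𝔼}
    (hy : y ∈ (chartAt 𝔼 p).target) :
    Function.Bijective (chartVector (chartAt 𝔼 p) y) := by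
  have h := (mdifferentiable_chart (I := 𝓡 n) p).symm
  exact (h.mfderiv hy).bijective

theorem chartVector_smul (e : OpenPartialHomeomorph M 𝔼) (y : 𝔼) (c : ℝ) (v : 𝔼) :
    chartVector e y (c • v) = c • chartVector e y v :=
  map_smul (mfderiv (𝓡 n) (𝓡 n) e.symm y) c v

theorem chartVector_eq_sum (e : OpenPartialHomeomorph M 𝔼) (y v : 𝔼) :
    chartVector e y v = ∑ i, v i • chartVector e y (EuclideanSpace.single i 1) := by
  have hv : v = ∑ i, v i • EuclideanSpace.single i (1 : ℝ) := by
    ext j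
    simp [Pi.single_apply]
  conv_lhs => rw [hv]
  exact (map_sum (mfderiv (𝓡 n) (𝓡 n) e.symm y) _ _).trans
    (Finset.sum_congr rfl fun i _ => chartVector_smul e y _ _)

/-- These are the coordinate vector fields, constant in the trivialization and therefore smooth.
This is where continuity of the `g_ij` comes from. -/
theorem contMDiffOn_chartVector [IsManifold (𝓡 n) ∞ M] (p : M) (v : 𝔼) :
    ContMDiffOn (𝓡 n) ((𝓡 n).prod (𝓡 n)) ∞
      (fun x : M => TotalSpace.mk' 𝔼 (E := fun x : M => TangentSpace (𝓡 n) x) x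
        ((trivializationAt 𝔼 (TangentSpace (𝓡 n)) p).symmL ℝ x v)) (chartAt 𝔼 p).source := by
  have h := (trivializationAt 𝔼 (TangentSpace (𝓡 n) : M → Type _) p).contMDiffOn_section_baseSet_iff
    (IB := 𝓡 n) (n := ∞)
    (s := fun x => (trivializationAt 𝔼 (TangentSpace (𝓡 n)) p).symmL ℝ x v)
  rw [TangentBundle.trivializationAt_baseSet] at h
  refine h.2 ((contMDiffOn_const (c := v)).congr fun x hx => ?_)
  rw [Bundle.Trivialization.symmL_apply _ (by simpa using hx)]
  exact congrArg Prod.snd (Bundle.Trivialization.apply_mk_symm _ (by simpa using hx) v)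

/-- The derivative of the inverse chart as a linear map of the model vector space. -/
def chartDeriv (e : OpenPartialHomeomorph M 𝔼) (y : 𝔼) : 𝔼 →L[ℝ] 𝔼 :=
  mfderiv (𝓡 n) (𝓡 n) e.symm y

theorem contDiffOn_comp_chartAt_symm [IsManifold (𝓡 n) ∞ M] (p : M) {f : M → ℝ}
    (hf : ContMDiff (𝓡 n) 𝓘(ℝ, ℝ) ∞ f) :
    ContDiffOn ℝ ∞ (fun z => f ((chartAt 𝔼 p).symm z)) (chartAt 𝔼 p).target := by
  rw [← contMDiffOn_iff_contDiffOn]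
  exact hf.comp_contMDiffOn (contMDiffOn_chart_symm (I := 𝓡 n) (x := p))

theorem contMDiff_comp_chartAt_mul [IsManifold (𝓡 n) ∞ M] (p : M) {F : ℝ → ℝ}
    (hF : ContDiffOn ℝ ∞ F (Set.Ioi 0))
    {R : 𝔼 → ℝ} (hR : ContDiff ℝ ∞ R) {ψ : M → ℝ} (hψ : ContMDiff (𝓡 n) 𝓘(ℝ, ℝ) ∞ ψ)
    (hψp : tsupport ψ ⊆ (chartAt 𝔼 p).source)
    (hpos : ∀ x ∈ tsupport ψ, 0 < R (chartAt 𝔼 p x)) :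
    ContMDiff (𝓡 n) 𝓘(ℝ, ℝ) ∞ fun x => F (R (chartAt 𝔼 p x)) * ψ x := by
  refine contMDiff_of_tsupport fun x hx => ?_
  have hxS : x ∈ tsupport ψ :=
    closure_mono (Function.support_mul_subset_right (fun x => F (R (chartAt 𝔼 p x))) ψ) hx
  have h1 : ContMDiffAt (𝓡 n) 𝓘(ℝ, ℝ) ∞ (fun x => R (chartAt 𝔼 p x)) x :=
    hR.contMDiff.contMDiffAt.comp x (contMDiffAt_of_mem_maximalAtlas
      (IsManifold.chart_mem_maximalAtlas p) (hψp hxS))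
  have h2 : ContMDiffAt 𝓘(ℝ, ℝ) 𝓘(ℝ, ℝ) ∞ F (R (chartAt 𝔼 p x)) :=
    (hF.contDiffAt (Ioi_mem_nhds (hpos x hxS))).contMDiffAt
  exact (h2.comp x h1).mul hψ.contMDiffAt

variable [RiemannianBundle (fun x : M => TangentSpace (𝓡 n) x)]

/-- The components `⟨X, ∂_i⟩` of a tangent vector in the chart `e`. -/
def covector (e : OpenPartialHomeomorph M 𝔼) (y : 𝔼) (X : TangentSpace (𝓡 n) (e.symm y)) :
    Fin n → ℝ :=
  fun i => inner ℝ X (chartVector e y (EuclideanSpace.single i 1))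

theorem covector_chartVector (e : OpenPartialHomeomorph M 𝔼) (y v : 𝔼) :
    covector e y (chartVector e y v) = (metricMatrix e y).mulVec v := by
  ext j
  rw [covector, chartVector_eq_sum, sum_inner]
  simp only [Matrix.mulVec, dotProduct, metricMatrix, Matrix.of_apply, inner_smul_left]
  refine Finset.sum_congr rfl fun i _ => ?_
  rw [real_inner_comm, mul_comm]; rfl

theorem inner_chartVector_left (e : OpenPartialHomeomorph M 𝔼) (y v : 𝔼)
    (Y : TangentSpace (𝓡 n) (e.symm y)) :
    inner ℝ (chartVector e y v) Y = (v : Fin n → ℝ) ⬝ᵥ covector e y Y := by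
  rw [chartVector_eq_sum, sum_inner]
  simp only [dotProduct, covector, inner_smul_left]
  refine Finset.sum_congr rfl fun i _ => ?_
  rw [real_inner_comm]; rfl

theorem metricMatrix_posDef [IsManifold (𝓡 n) ∞ M] (p : M) {y : 𝔼}
    (hy : y ∈ (chartAt 𝔼 p).target) : (metricMatrix (chartAt 𝔼 p) y).PosDef := by
  refine Matrix.PosDef.of_dotProduct_mulVec_pos ?_ fun x hx => ?_
  · ext i j
    simp only [metricMatrix, Matrix.conjTranspose_apply, Matrix.of_apply, star_trivial]
    exact real_inner_comm _ _
  · set v : 𝔼 := WithLp.toLp 2 x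
    have h : star x ⬝ᵥ (metricMatrix (chartAt 𝔼 p) y).mulVec x =
        inner ℝ (chartVector (chartAt 𝔼 p) y v) (chartVector (chartAt 𝔼 p) y v) := by
      rw [inner_chartVector_left, covector_chartVector]; rfl
    rw [h, real_inner_self_eq_norm_sq]
    have hne : chartVector (chartAt 𝔼 p) y v ≠ 0 := by
      intro h0
      apply hx
      have h00 : chartVector (chartAt 𝔼 p) y 0 = 0 :=
        map_zero (mfderiv (𝓡 n) (𝓡 n) (chartAt 𝔼 p).symm y)
      have := (chartVector_bijective p hy).1 (h0.trans h00.symm)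
      simpa [v] using this
    positivity

/-- Weak gradients are controlled only through their lowered components `⟨G, ∂_i⟩`, so inner
products have to be computed with the inverse metric. -/
theorem inner_eq_covector [IsManifold (𝓡 n) ∞ M] (p : M) {y : 𝔼}
    (hy : y ∈ (chartAt 𝔼 p).target) (X Y : TangentSpace (𝓡 n) ((chartAt 𝔼 p).symm y)) :
    inner ℝ X Y = ((metricMatrix (chartAt 𝔼 p) y)⁻¹).mulVec (covector (chartAt 𝔼 p) y X) ⬝ᵥ
      covector (chartAt 𝔼 p) y Y := by
  obtain ⟨v, rfl⟩ := (chartVector_bijective p hy).2 X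
  rw [inner_chartVector_left, covector_chartVector, Matrix.mulVec_mulVec,
    Matrix.nonsing_inv_mul _ (metricMatrix_posDef p hy).det_pos.ne'.isUnit, Matrix.one_mulVec]

theorem inner_grad (f : M → ℝ) (x : M) (X : TangentSpace (𝓡 n) x) :
    inner ℝ (grad f x) X = mvfderiv (𝓡 n) f x X := by
  have := completeSpace_tangentSpace (n := n) x
  exact InnerProductSpace.toDual_symm_apply

theorem covector_grad [IsManifold (𝓡 n) ∞ M] (p : M) {y : 𝔼}
    (hy : y ∈ (chartAt 𝔼 p).target) {f : M → ℝ}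
    (hf : MDifferentiableAt (𝓡 n) 𝓘(ℝ, ℝ) f ((chartAt 𝔼 p).symm y)) :
    covector (chartAt 𝔼 p) y (grad f _) =
      fun i => fderiv ℝ (fun z => f ((chartAt 𝔼 p).symm z)) y (EuclideanSpace.single i 1) := by
  ext i
  rw [covector, inner_grad, mvfderiv_chartVector p hy hf]

theorem grad_mul {f g : M → ℝ} {x : M} (hf : MDifferentiableAt (𝓡 n) 𝓘(ℝ, ℝ) f x)
    (hg : MDifferentiableAt (𝓡 n) 𝓘(ℝ, ℝ) g x) :
    grad (n := n) (fun z => f z * g z) x = f x • grad g x + g x • grad f x := by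
  refine ext_inner_right ℝ fun X => ?_
  rw [inner_add_left, real_inner_smul_left, real_inner_smul_left, inner_grad, inner_grad,
    inner_grad, mvfderiv_fun_mul hf hg]
  rfl

theorem grad_add {f g : M → ℝ} {x : M} (hf : MDifferentiableAt (𝓡 n) 𝓘(ℝ, ℝ) f x)
    (hg : MDifferentiableAt (𝓡 n) 𝓘(ℝ, ℝ) g x) :
    grad (n := n) (fun z => f z + g z) x = grad f x + grad g x := by
  refine ext_inner_right ℝ fun X => ?_
  rw [inner_add_left, inner_grad, inner_grad, inner_grad, mvfderiv_fun_add hf hg]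
  rfl

theorem grad_comp {f : M → ℝ} {x : M} {F : ℝ → ℝ} {c : ℝ} (hF : HasDerivAt F c (f x))
    (hf : MDifferentiableAt (𝓡 n) 𝓘(ℝ, ℝ) f x) :
    grad (n := n) (fun z => F (f z)) x = c • grad f x := by
  refine ext_inner_right ℝ fun X => ?_
  rw [real_inner_smul_left, inner_grad, inner_grad]
  have h := mfderiv_comp_apply (I'' := 𝓘(ℝ, ℝ)) x
    (hF.differentiableAt.mdifferentiableAt) hf X
  have h2 : mfderiv 𝓘(ℝ, ℝ) 𝓘(ℝ, ℝ) F (f x) = fderiv ℝ F (f x) := mfderiv_eq_fderiv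
  rw [h2, hF.hasFDerivAt.fderiv] at h
  refine Eq.trans h ?_
  exact mul_comm _ _

theorem continuousOn_metricMatrix [IsManifold (𝓡 n) ∞ M]
    [IsContMDiffRiemannianBundle (𝓡 n) ∞ 𝔼 (fun x : M => TangentSpace (𝓡 n) x)] (p : M) :
    ContinuousOn (metricMatrix (chartAt 𝔼 p)) (chartAt 𝔼 p).target := by
  refine continuousOn_pi.2 fun i => continuousOn_pi.2 fun j => ?_
  have h := ((contMDiffOn_chartVector p (EuclideanSpace.single i 1)).inner_bundle
    (contMDiffOn_chartVector p (EuclideanSpace.single j 1))).continuousOn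
  refine (h.comp (chartAt 𝔼 p).continuousOn_symm
    fun y hy => (chartAt 𝔼 p).map_target hy).congr fun y hy => ?_
  have key : ∀ v, chartVector (chartAt 𝔼 p) y v =
      (trivializationAt 𝔼 (TangentSpace (𝓡 n)) p).symmL ℝ ((chartAt 𝔼 p).symm y) v := by
    intro v
    rw [TangentBundle.symmL_trivializationAt ((chartAt 𝔼 p).map_target hy)]
    simp only [extChartAt, OpenPartialHomeomorph.extend, modelWithCornersSelf_partialEquiv,
      Set.range_id, modelWithCornersSelf_coe, mfderivWithin_univ]
    -- The derivative on the right is taken at `e (e.symm y)`, equal to `y` only propositionally.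
    -- `chartDeriv` has a type independent of the point, so the point can be generalized and
    -- substituted.
    have aux : ∀ z : 𝔼, z = y → chartVector (chartAt 𝔼 p) y v = chartDeriv (chartAt 𝔼 p) z v := by
      rintro z rfl
      rfl
    exact aux _ ((chartAt 𝔼 p).right_inv hy)
  simp only [metricMatrix, Matrix.of_apply, Function.comp_apply]
  rw [key, key]

/-- The metric at `x` on the model vector space. -/
def innerAt (x : M) (v w : 𝔼) : ℝ :=
  inner ℝ (show TangentSpace (𝓡 n) x from v) (show TangentSpace (𝓡 n) x from w)

/-- By the chain rule the matrices are congruent, `g_p = Aᵀ g_q A` with `A` the derivative of the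
transition map; take determinants. -/
theorem metricMatrix_change [IsManifold (𝓡 n) ∞ M] (p q : M) {y : 𝔼}
    (hy : y ∈ (chartAt 𝔼 p).target) (hq : (chartAt 𝔼 p).symm y ∈ (chartAt 𝔼 q).source) :
    ∃ A : 𝔼 →L[ℝ] 𝔼,
      HasFDerivAt (fun z => chartAt 𝔼 q ((chartAt 𝔼 p).symm z)) A y ∧
      (metricMatrix (chartAt 𝔼 p) y).det = A.det ^ 2 *
        (metricMatrix (chartAt 𝔼 q) (chartAt 𝔼 q ((chartAt 𝔼 p).symm y))).det := by
  have hd1 : MDifferentiableAt (𝓡 n) (𝓡 n) (fun z => chartAt 𝔼 q ((chartAt 𝔼 p).symm z)) y :=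
    MDifferentiableAt.comp y (mdifferentiableAt_atlas (I := 𝓡 n) (chart_mem_atlas 𝔼 q) hq)
      (mdifferentiableAt_chartAt_symm p hy)
  have hd := hd1.differentiableAt
  refine ⟨_, hd.hasFDerivAt, ?_⟩
  set T := fun z => chartAt 𝔼 q ((chartAt 𝔼 p).symm z) with hT
  set A := fderiv ℝ T y with hA
  have hTy : T y ∈ (chartAt 𝔼 q).target := (chartAt 𝔼 q).map_source hq
  have hback : (chartAt 𝔼 q).symm (T y) = (chartAt 𝔼 p).symm y := (chartAt 𝔼 q).left_inv hq
  have hchain : chartDeriv (chartAt 𝔼 p) y = (chartDeriv (chartAt 𝔼 q) (T y)).comp A := by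
    have h := mfderiv_comp y (mdifferentiableAt_chartAt_symm q hTy) hd1
    have heq : (chartAt 𝔼 p).symm =ᶠ[nhds y] (chartAt 𝔼 q).symm ∘ T := by
      have h1 : (chartAt 𝔼 p).symm ⁻¹' (chartAt 𝔼 q).source ∈ nhds y :=
        ((chartAt 𝔼 p).continuousAt_symm hy).preimage_mem_nhds
          ((chartAt 𝔼 q).open_source.mem_nhds hq)
      filter_upwards [h1] with z hz
      exact ((chartAt 𝔼 q).left_inv hz).symm
    rw [chartDeriv, heq.mfderiv_eq, h, mfderiv_eq_fderiv]; rfl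
  have hg : ∀ (e : OpenPartialHomeomorph M 𝔼) (z v w : 𝔼),
      innerAt (e.symm z) (chartDeriv e z v) (chartDeriv e z w) =
        (v : Fin n → ℝ) ⬝ᵥ (metricMatrix e z).mulVec w := by
    intro e z v w
    rw [← covector_chartVector, ← inner_chartVector_left]; rfl
  have hmat : metricMatrix (chartAt 𝔼 p) y =
      (LinearMap.toMatrix (EuclideanSpace.basisFun (Fin n) ℝ).toBasis
        (EuclideanSpace.basisFun (Fin n) ℝ).toBasis A).transpose *
      metricMatrix (chartAt 𝔼 q) (T y) *
      (LinearMap.toMatrix (EuclideanSpace.basisFun (Fin n) ℝ).toBasis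
        (EuclideanSpace.basisFun (Fin n) ℝ).toBasis A) := by
    ext i j
    have h1 : metricMatrix (chartAt 𝔼 p) y i j = innerAt ((chartAt 𝔼 p).symm y)
      (chartDeriv (chartAt 𝔼 p) y (EuclideanSpace.single i 1))
      (chartDeriv (chartAt 𝔼 p) y (EuclideanSpace.single j 1)) := rfl
    rw [h1, hchain, ← hback]
    simp only [ContinuousLinearMap.comp_apply]
    rw [hg, Matrix.mul_assoc, Matrix.mul_apply]
    simp only [dotProduct, Matrix.mulVec, Matrix.mul_apply, Matrix.transpose_apply,
      LinearMap.toMatrix_apply]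
    simp
  rw [hmat, Matrix.det_mul, Matrix.det_mul, Matrix.det_transpose, LinearMap.det_toMatrix]
  change _ = (LinearMap.det (A : 𝔼 →ₗ[ℝ] 𝔼)) ^ 2 * _
  ring

end Charts

/-! ### The Riemannian volume: independence of charts, null sets, measurability -/

section Volume

theorem measurableSet_inter_preimage_of_continuousOn {X Y : Type*} [TopologicalSpace X]
    [MeasurableSpace X] [OpensMeasurableSpace X] [TopologicalSpace Y] [MeasurableSpace Y]
    [BorelSpace Y] {f : X → Y} {t : Set X} {s : Set Y} (hf : ContinuousOn f t)
    (ht : MeasurableSet t) (hs : MeasurableSet s) : MeasurableSet (t ∩ f ⁻¹' s) := by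
  have h : Continuous fun x : t => f x := continuousOn_iff_continuous_domRestrict.1 hf
  have := MeasurableSet.subtype_image ht (h.measurable hs)
  convert this using 1
  ext x
  simp [and_comm]

variable {n : ℕ} {M : Type*} [TopologicalSpace M] [ChartedSpace (EuclideanSpace ℝ (Fin n)) M]

local notation "𝔼" => EuclideanSpace ℝ (Fin n)

theorem measurableSet_target_inter [MeasurableSpace M] [BorelSpace M] (p : M) {s : Set M}
    (hs : MeasurableSet s) :
    MeasurableSet ((chartAt 𝔼 p).target ∩ (chartAt 𝔼 p).symm ⁻¹' s) :=
  measurableSet_inter_preimage_of_continuousOn (chartAt 𝔼 p).continuousOn_symm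
    (chartAt 𝔼 p).open_target.measurableSet hs

variable [RiemannianBundle (fun x : M => TangentSpace (𝓡 n) x)]

/-- The chart measure on the model space. -/
def chartMeasure (p : M) : Measure 𝔼 :=
  ((volume : Measure 𝔼).restrict (chartAt 𝔼 p).target).withDensity
    fun y => ENNReal.ofReal (Real.sqrt (metricMatrix (chartAt 𝔼 p) y).det)

theorem chartMeasure_absolutelyContinuous (p : M) :
    chartMeasure p ≪ (volume : Measure 𝔼).restrict (chartAt 𝔼 p).target :=
  withDensity_absolutelyContinuous _ _

variable [MeasurableSpace M]

theorem chartVolume_eq_map (p : M) :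
    chartVolume (chartAt 𝔼 p) = Measure.map (chartAt 𝔼 p).symm (chartMeasure p) := rfl

variable [BorelSpace M]

theorem aemeasurable_chartAt_symm (p : M) :
    AEMeasurable (chartAt 𝔼 p).symm (chartMeasure p) :=
  ((chartAt 𝔼 p).continuousOn_symm.aemeasurable
    (chartAt 𝔼 p).open_target.measurableSet).mono_ac (chartMeasure_absolutelyContinuous p)

theorem chartVolume_apply (p : M) {s : Set M} (hs : MeasurableSet s) :
    chartVolume (chartAt 𝔼 p) s =
      ∫⁻ y in (chartAt 𝔼 p).target ∩ (chartAt 𝔼 p).symm ⁻¹' s,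
        ENNReal.ofReal (Real.sqrt (metricMatrix (chartAt 𝔼 p) y).det) := by
  rw [chartVolume_eq_map, Measure.map_apply_of_aemeasurable (aemeasurable_chartAt_symm p) hs,
    chartMeasure, withDensity_apply', Measure.restrict_restrict'
      (chartAt 𝔼 p).open_target.measurableSet, Set.inter_comm]

theorem chartVolume_compl_source (p : M) :
    chartVolume (chartAt 𝔼 p) (chartAt 𝔼 p).sourceᶜ = 0 := by
  rw [chartVolume_apply p (chartAt 𝔼 p).open_source.measurableSet.compl]
  have : (chartAt 𝔼 p).target ∩ (chartAt 𝔼 p).symm ⁻¹' (chartAt 𝔼 p).sourceᶜ = ∅ := by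
    ext y
    simp only [Set.mem_inter_iff, Set.mem_preimage, Set.mem_compl_iff, Set.mem_empty_iff_false,
      iff_false, not_and, not_not]
    exact fun hy => (chartAt 𝔼 p).map_target hy
  rw [this]
  simp

variable [IsManifold (𝓡 n) ∞ M]

/-- Change of variables along the transition map: its Jacobian `|det A|` is the ratio of the two
densities, by `metricMatrix_change`. -/
theorem chartVolume_eq_of_subset (p q : M) {s : Set M} (hs : MeasurableSet s)
    (hp : s ⊆ (chartAt 𝔼 p).source) (hq : s ⊆ (chartAt 𝔼 q).source) :
    chartVolume (chartAt 𝔼 p) s = chartVolume (chartAt 𝔼 q) s := by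
  set T := fun z => chartAt 𝔼 q ((chartAt 𝔼 p).symm z) with hT
  set S := (chartAt 𝔼 p).target ∩ (chartAt 𝔼 p).symm ⁻¹' s with hS
  have hSm : MeasurableSet S := measurableSet_target_inter p hs
  have himage : T '' S = (chartAt 𝔼 q).target ∩ (chartAt 𝔼 q).symm ⁻¹' s := by
    ext z
    constructor
    · rintro ⟨y, ⟨hy, hys⟩, rfl⟩
      refine ⟨(chartAt 𝔼 q).map_source (hq hys), ?_⟩
      rw [Set.mem_preimage, hT]
      simp only
      rw [(chartAt 𝔼 q).left_inv (hq hys)]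
      exact hys
    · rintro ⟨hz, hzs⟩
      refine ⟨chartAt 𝔼 p ((chartAt 𝔼 q).symm z), ⟨(chartAt 𝔼 p).map_source (hp hzs), ?_⟩, ?_⟩
      · rw [Set.mem_preimage, (chartAt 𝔼 p).left_inv (hp hzs)]
        exact hzs
      · simp only [hT]
        rw [(chartAt 𝔼 p).left_inv (hp hzs), (chartAt 𝔼 q).right_inv hz]
  have hinj : Set.InjOn T S := by
    rintro y ⟨hy, hys⟩ z ⟨hz, hzs⟩ h
    have h1 := (chartAt 𝔼 q).injOn (hq hys) (hq hzs) h
    exact (chartAt 𝔼 p).symm.injOn hy hz h1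
  have hder : ∀ y, ∃ A : 𝔼 →L[ℝ] 𝔼, y ∈ S → HasFDerivAt T A y ∧
      (metricMatrix (chartAt 𝔼 p) y).det = A.det ^ 2 *
        (metricMatrix (chartAt 𝔼 q) (T y)).det := by
    intro y
    by_cases hy : y ∈ S
    · obtain ⟨A, hA⟩ := metricMatrix_change p q hy.1 (hq hy.2)
      exact ⟨A, fun _ => hA⟩
    · exact ⟨0, fun h => absurd h hy⟩
  choose A hA using hder
  rw [chartVolume_apply p hs, chartVolume_apply q hs, ← himage,
    lintegral_image_eq_lintegral_abs_det_fderiv_mul volume hSm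
      (fun y hy => (hA y hy).1.hasFDerivWithinAt) hinj]
  refine setLIntegral_congr_fun hSm fun y hy => ?_
  rw [← ENNReal.ofReal_mul (abs_nonneg _), (hA y hy).2, Real.sqrt_mul (sq_nonneg _),
    Real.sqrt_sq_eq_abs]

variable [SecondCountableTopology M] [Nonempty M]

/-- On each piece of the partition the chart used in the gluing can be exchanged for the one at `p`;
the pieces then add up. All local statements about `dv_g` reduce to Lebesgue measure through this.
-/
theorem riemannianVolume_restrict_source (p : M) :
    (riemannianVolume n M).restrict (chartAt 𝔼 p).source = chartVolume (chartAt 𝔼 p) := by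
  have hcov : ⋃ i, (chartAt 𝔼 (chartCenter n M i)).source = Set.univ :=
    (exists_chart_cover n M).choose_spec
  set U : ℕ → Set M := fun j => (chartAt 𝔼 (chartCenter n M j)).source with hU
  have hD : ∀ i, MeasurableSet (disjointed U i) := fun i =>
    MeasurableSet.disjointed (fun j => (chartAt 𝔼 _).open_source.measurableSet) i
  have hsrc : MeasurableSet (chartAt 𝔼 p).source := (chartAt 𝔼 p).open_source.measurableSet
  ext s hs
  rw [Measure.restrict_apply hs, riemannianVolume, Measure.sum_apply _ (hs.inter hsrc)]
  have h1 : ∀ i, ((chartVolume (chartAt 𝔼 (chartCenter n M i))).restrict (disjointed U i))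
      (s ∩ (chartAt 𝔼 p).source) =
      (chartVolume (chartAt 𝔼 p)) ((s ∩ (chartAt 𝔼 p).source) ∩ disjointed U i) := by
    intro i
    rw [Measure.restrict_apply (hs.inter hsrc)]
    exact chartVolume_eq_of_subset _ _ ((hs.inter hsrc).inter (hD i))
      (fun x hx => disjointed_subset U i hx.2) fun x hx => hx.1.2
  refine (tsum_congr h1).trans ?_
  rw [← measure_iUnion]
  · rw [← Set.inter_iUnion, iUnion_disjointed, hcov, Set.inter_univ]
    exact measure_inter_conull (chartVolume_compl_source p)
  · intro i j hij
    exact (disjoint_disjointed U hij).mono Set.inter_subset_right Set.inter_subset_right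
  · exact fun i => (hs.inter hsrc).inter (hD i)

/-- The density `√(det g)` is strictly positive on the target, so Lebesgue measure there is
absolutely continuous with respect to the chart measure. -/
theorem ae_chart_of_ae {p : M} {P : M → Prop} (h : ∀ᵐ x ∂riemannianVolume n M, P x)
    [IsContMDiffRiemannianBundle (𝓡 n) ∞ 𝔼 (fun x : M => TangentSpace (𝓡 n) x)] :
    ∀ᵐ y ∂(volume : Measure 𝔼).restrict (chartAt 𝔼 p).target, P ((chartAt 𝔼 p).symm y) := by
  have h1 : ∀ᵐ x ∂chartVolume (chartAt 𝔼 p), P x := by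
    rw [← riemannianVolume_restrict_source]
    exact ae_restrict_of_ae h
  rw [chartVolume_eq_map] at h1
  have h2 := ae_of_ae_map (aemeasurable_chartAt_symm p) h1
  have htm := (chartAt 𝔼 p).open_target.measurableSet
  refine (withDensity_absolutelyContinuous' (μ := volume.restrict (chartAt 𝔼 p).target)
    (f := fun y => ENNReal.ofReal (Real.sqrt (metricMatrix (chartAt 𝔼 p) y).det)) ?_ ?_).ae_le h2
  · refine (ContinuousOn.aemeasurable ?_ htm).ennreal_ofReal
    refine Real.continuous_sqrt.comp_continuousOn ?_
    exact (Continuous.matrix_det continuous_id).comp_continuousOn (continuousOn_metricMatrix p)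
  · filter_upwards [ae_restrict_mem htm] with y hy
    have := Real.sqrt_pos.2 (metricMatrix_posDef p hy).det_pos
    simpa using this

theorem ae_source_of_ae_chart {p : M} {P : M → Prop}
    (h : ∀ᵐ y ∂(volume : Measure 𝔼).restrict (chartAt 𝔼 p).target, P ((chartAt 𝔼 p).symm y)) :
    ∀ᵐ x ∂riemannianVolume n M, x ∈ (chartAt 𝔼 p).source → P x := by
  rw [← ae_restrict_iff' (chartAt 𝔼 p).open_source.measurableSet,
    riemannianVolume_restrict_source]
  have hN : (volume.restrict (chartAt 𝔼 p).target) {y | ¬ P ((chartAt 𝔼 p).symm y)} = 0 :=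
    ae_iff.1 h
  -- `P` need not be measurable, so the exceptional set is first enlarged to a measurable null set,
  -- which can be pulled back by the chart.
  obtain ⟨N, hsub, hNm, hN0⟩ := exists_measurable_superset_of_null hN
  have hm : MeasurableSet ((chartAt 𝔼 p).source ∩ chartAt 𝔼 p ⁻¹' N) :=
    measurableSet_inter_preimage_of_continuousOn (chartAt 𝔼 p).continuousOn
      (chartAt 𝔼 p).open_source.measurableSet hNm
  have h0 : chartVolume (chartAt 𝔼 p) ((chartAt 𝔼 p).source ∩ chartAt 𝔼 p ⁻¹' N) = 0 := by
    rw [chartVolume_eq_map, Measure.map_apply_of_aemeasurable (aemeasurable_chartAt_symm p) hm]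
    refine chartMeasure_absolutelyContinuous p (measure_mono_null ?_
      ((measure_union_null (t := (chartAt 𝔼 p).targetᶜ) hN0 ?_)))
    · intro y hy
      by_cases ht : y ∈ (chartAt 𝔼 p).target
      · left
        have := hy.2
        rwa [Set.mem_preimage, (chartAt 𝔼 p).right_inv ht] at this
      · exact Or.inr ht
    · exact ae_restrict_mem (chartAt 𝔼 p).open_target.measurableSet
  refine ae_iff.2 (measure_mono_null ?_ (measure_union_null h0 (chartVolume_compl_source p)))
  intro x hx
  by_cases hs : x ∈ (chartAt 𝔼 p).source
  · left
    refine ⟨hs, hsub ?_⟩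
    rw [Set.mem_ofPred_eq, (chartAt 𝔼 p).left_inv hs]
    exact hx
  · exact Or.inr hs

/-- The chart pushes `chartVolume` forward to `chartMeasure`, so measurability of the coordinate
expression pulls back along it. -/
theorem aestronglyMeasurable_restrict_source {p : M} {f : M → ℝ}
    (hf : AEStronglyMeasurable (fun y => f ((chartAt 𝔼 p).symm y))
      ((volume : Measure 𝔼).restrict (chartAt 𝔼 p).target)) :
    AEStronglyMeasurable f ((riemannianVolume n M).restrict (chartAt 𝔼 p).source) := by
  rw [riemannianVolume_restrict_source]
  have hsm := (chartAt 𝔼 p).open_source.measurableSet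
  have hm : AEMeasurable (chartAt 𝔼 p) (chartVolume (chartAt 𝔼 p)) := by
    rw [← Measure.restrict_eq_self_of_ae_mem (s := (chartAt 𝔼 p).source)
      (μ := chartVolume (chartAt 𝔼 p)) (chartVolume_compl_source p)]
    exact (chartAt 𝔼 p).continuousOn.aemeasurable hsm
  have hmap : Measure.map (chartAt 𝔼 p) (chartVolume (chartAt 𝔼 p)) = chartMeasure p := by
    rw [chartVolume_eq_map, AEMeasurable.map_map_of_aemeasurable _ (aemeasurable_chartAt_symm p)]
    · conv_rhs => rw [← Measure.map_id (μ := chartMeasure p)]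
      refine Measure.map_congr ?_
      refine (chartMeasure_absolutelyContinuous p).ae_le ?_
      filter_upwards [ae_restrict_mem (chartAt 𝔼 p).open_target.measurableSet] with y hy
      exact (chartAt 𝔼 p).right_inv hy
    · exact hm
  have h1 : AEStronglyMeasurable (fun y => f ((chartAt 𝔼 p).symm y))
      (Measure.map (chartAt 𝔼 p) (chartVolume (chartAt 𝔼 p))) := by
    rw [hmap]
    exact hf.mono_ac (chartMeasure_absolutelyContinuous p)
  refine (h1.comp_aemeasurable hm).congr ?_
  have : ∀ᵐ x ∂chartVolume (chartAt 𝔼 p), x ∈ (chartAt 𝔼 p).source :=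
    chartVolume_compl_source p
  filter_upwards [this] with x hx
  simp [(chartAt 𝔼 p).left_inv hx]

theorem aestronglyMeasurable_of_charts {f : M → ℝ}
    (hf : ∀ p : M, AEStronglyMeasurable (fun y => f ((chartAt 𝔼 p).symm y))
      ((volume : Measure 𝔼).restrict (chartAt 𝔼 p).target)) :
    AEStronglyMeasurable f (riemannianVolume n M) := by
  obtain ⟨c, hc⟩ := exists_chart_cover n M
  rw [← Measure.restrict_univ (μ := riemannianVolume n M), ← hc]
  exact aestronglyMeasurable_iUnion_iff.2 fun i => aestronglyMeasurable_restrict_source (hf (c i))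

theorem isLocallyFiniteMeasure_riemannianVolume
    [IsContMDiffRiemannianBundle (𝓡 n) ∞ 𝔼 (fun x : M => TangentSpace (𝓡 n) x)] :
    IsLocallyFiniteMeasure (riemannianVolume n M) := by
  refine ⟨fun x => ?_⟩
  obtain ⟨r, hr, hball⟩ := Metric.nhds_basis_closedBall.mem_iff.1
    ((chartAt 𝔼 x).open_target.mem_nhds (mem_chart_target 𝔼 x))
  set U := (chartAt 𝔼 x).source ∩ chartAt 𝔼 x ⁻¹' Metric.ball (chartAt 𝔼 x x) r with hU
  have hUo : IsOpen U := (chartAt 𝔼 x).isOpen_inter_preimage Metric.isOpen_ball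
  refine ⟨U, hUo.mem_nhds ⟨mem_chart_source 𝔼 x, Metric.mem_ball_self hr⟩, ?_⟩
  have h1 : riemannianVolume n M U = chartVolume (chartAt 𝔼 x) U := by
    rw [← riemannianVolume_restrict_source, Measure.restrict_apply hUo.measurableSet,
      Set.inter_eq_left.2 Set.inter_subset_left]
  rw [h1, chartVolume_apply x hUo.measurableSet]
  have hcont : ContinuousOn (fun y => Real.sqrt (metricMatrix (chartAt 𝔼 x) y).det)
      (Metric.closedBall (chartAt 𝔼 x x) r) :=
    (Real.continuous_sqrt.comp_continuousOn ((Continuous.matrix_det continuous_id).comp_continuousOn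
      (continuousOn_metricMatrix x))).mono hball
  obtain ⟨B, hB⟩ := (isCompact_closedBall (chartAt 𝔼 x x) r).exists_bound_of_continuousOn hcont
  calc _ ≤ ∫⁻ y in Metric.closedBall (chartAt 𝔼 x x) r,
        ENNReal.ofReal (Real.sqrt (metricMatrix (chartAt 𝔼 x) y).det) := by
        refine lintegral_mono_set fun y hy => ?_
        have h2 := hy.2.2
        rw [Set.mem_preimage, (chartAt 𝔼 x).right_inv hy.1] at h2
        exact Metric.ball_subset_closedBall h2
    _ ≤ ∫⁻ y in Metric.closedBall (chartAt 𝔼 x x) r, ENNReal.ofReal B := by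
        refine setLIntegral_mono' Metric.isClosed_closedBall.measurableSet fun y hy => ?_
        exact ENNReal.ofReal_le_ofReal ((le_abs_self _).trans (hB y hy))
    _ < ⊤ := by
        rw [setLIntegral_const]
        exact ENNReal.mul_lt_top ENNReal.ofReal_lt_top measure_closedBall_lt_top

end Volume

/-! ### Mollification of bounded functions with weak derivatives -/

section Mollification

open Filter Topology Metric ContinuousLinearMap

variable {E : Type*} [NormedAddCommGroup E] [InnerProductSpace ℝ E] [FiniteDimensional ℝ E]
  [MeasurableSpace E] [BorelSpace E]

/-- Convolution of a function with a normalised bump function. -/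
def mollify (φ : ContDiffBump (0 : E)) (h : E → ℝ) : E → ℝ :=
  convolution (φ.normed volume) h (lsmul ℝ ℝ) volume

theorem mollify_apply (φ : ContDiffBump (0 : E)) (h : E → ℝ) (y : E) :
    mollify φ h y = ∫ t, φ.normed volume (y - t) * h t :=
  convolution_eq_swap _

theorem contDiff_mollify (φ : ContDiffBump (0 : E)) {h : E → ℝ}
    (hh : LocallyIntegrable h volume) : ContDiff ℝ ∞ (mollify φ h) :=
  φ.hasCompactSupport_normed.contDiff_convolution_left _ φ.contDiff_normed hh

/-- A mollification is an average over the ball of radius `rOut`, and so obeys any bounds that hold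
almost everywhere there. -/
theorem mollify_mem_Icc (φ : ContDiffBump (0 : E)) {h : E → ℝ}
    (hh : LocallyIntegrable h volume) {U : Set E} {y : E} (hU : ball y φ.rOut ⊆ U) {a b : ℝ}
    (hab : ∀ᵐ t, t ∈ U → h t ∈ Set.Icc a b) : mollify φ h y ∈ Set.Icc a b := by
  have hint : Integrable fun t => φ.normed volume (y - t) * h t :=
    (φ.hasCompactSupport_normed.convolutionExists_left (lsmul ℝ ℝ) φ.continuous_normed hh
      y).integrable_swap
  have hintc : ∀ c : ℝ, Integrable fun t => φ.normed volume (y - t) * c := fun c =>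
    (φ.integrable_normed.comp_sub_left y).mul_const c
  have hc : ∀ c : ℝ, ∫ t, φ.normed volume (y - t) * c = c := fun c => by
    rw [integral_mul_const, integral_sub_left_eq_self (φ.normed volume), φ.integral_normed, one_mul]
  have hz : ∀ t, t ∉ U → φ.normed volume (y - t) = 0 := by
    intro t ht
    have : y - t ∉ Function.support (φ.normed volume) := by
      rw [φ.support_normed_eq, mem_ball_zero_iff, ← dist_eq_norm, dist_comm]
      exact fun h => ht (hU h)
    simpa using this
  rw [mollify_apply]
  constructor
  · rw [← hc a]
    refine integral_mono_ae (hintc a) hint ?_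
    filter_upwards [hab] with t ht
    by_cases htU : t ∈ U
    · exact mul_le_mul_of_nonneg_left (ht htU).1 (φ.nonneg_normed _)
    · simp [hz t htU]
  · rw [← hc b]
    refine integral_mono_ae hint (hintc b) ?_
    filter_upwards [hab] with t ht
    by_cases htU : t ∈ U
    · exact mul_le_mul_of_nonneg_left (ht htU).2 (φ.nonneg_normed _)
    · simp [hz t htU]

/-- The derivative falls on the kernel, and the reflected kernel `t ↦ φ (y - t)` is a test function
supported in `U`. The sign from the reflection cancels the one in the definition of the weak
derivative. -/
theorem fderiv_mollify (φ : ContDiffBump (0 : E)) {r g : E → ℝ} {U : Set E} (hU : MeasurableSet U)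
    (hr : LocallyIntegrable (U.indicator r) volume) {v : E}
    (hw : ∀ η : E → ℝ, ContDiff ℝ ∞ η → HasCompactSupport η → tsupport η ⊆ U →
      ∫ y in U, r y * fderiv ℝ η y v = -∫ y in U, g y * η y)
    {y : E} (hy : closedBall y φ.rOut ⊆ U) :
    fderiv ℝ (mollify φ (U.indicator r)) y v = mollify φ (U.indicator g) y := by
  have hcs := φ.hasCompactSupport_normed (μ := volume)
  have hφ : ContDiff ℝ ∞ (φ.normed volume) := φ.contDiff_normed (n := ⊤)
  have hφ1 : ContDiff ℝ 1 (φ.normed volume) := hφ.of_le (by exact_mod_cast le_top)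
  have hd := hcs.hasFDerivAt_convolution_left (lsmul ℝ ℝ) hφ1 hr y
  have hex : Integrable fun t =>
      ((lsmul ℝ ℝ : ℝ →L[ℝ] ℝ →L[ℝ] ℝ).precompL E) (fderiv ℝ (φ.normed volume) (y - t))
        (U.indicator r t) :=
    ((hcs.fderiv ℝ).convolutionExists_left _ (hφ1.continuous_fderiv one_ne_zero) hr
      y).integrable_swap
  set η : E → ℝ := fun t => φ.normed volume (y - t) with hη
  have hη_smooth : ContDiff ℝ ∞ η := hφ.comp (contDiff_const.sub contDiff_id)
  have hη_supp : Function.support η ⊆ closedBall y φ.rOut := by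
    intro t ht
    have : y - t ∈ Function.support (φ.normed volume) := ht
    rw [φ.support_normed_eq, mem_ball_zero_iff, ← dist_eq_norm, dist_comm] at this
    exact ball_subset_closedBall this
  have hη_ts : tsupport η ⊆ closedBall y φ.rOut := closure_minimal hη_supp isClosed_closedBall
  have hη_cs : HasCompactSupport η :=
    HasCompactSupport.intro' (isCompact_closedBall y φ.rOut) isClosed_closedBall fun t ht => by
      by_contra h
      exact ht (hη_supp h)
  have hη_der : ∀ t, fderiv ℝ η t v = -fderiv ℝ (φ.normed volume) (y - t) v := by
    intro t
    have h1 : HasFDerivAt (fun t : E => y - t) (-ContinuousLinearMap.id ℝ E) t :=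
      (hasFDerivAt_id t).const_sub y
    have h2 := ((hφ1.differentiable one_ne_zero) (y - t)).hasFDerivAt.comp t h1
    rw [show η = φ.normed volume ∘ fun t => y - t from rfl, h2.fderiv]
    simp
  rw [mollify, hd.fderiv, convolution_eq_swap, ContinuousLinearMap.integral_apply hex,
    mollify_apply]
  have hw' := hw η hη_smooth hη_cs (hη_ts.trans hy)
  calc ∫ t, ((lsmul ℝ ℝ : ℝ →L[ℝ] ℝ →L[ℝ] ℝ).precompL E) (fderiv ℝ (φ.normed volume) (y - t))
        (U.indicator r t) v
      = ∫ t, U.indicator (fun t => -(r t * fderiv ℝ η t v)) t := by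
        refine integral_congr_ae (ae_of_all _ fun t => ?_)
        by_cases ht : t ∈ U
        · simp [ht, precompL_apply, hη_der, mul_comm]
        · simp [ht]
    _ = ∫ t in U, g t * η t := by
        rw [integral_indicator hU, integral_neg, hw', neg_neg]
    _ = ∫ t, φ.normed volume (y - t) * U.indicator g t := by
        rw [← integral_indicator hU]
        refine integral_congr_ae (ae_of_all _ fun t => ?_)
        by_cases ht : t ∈ U
        · simp [ht, hη, mul_comm]
        · simp [ht]

theorem locallyIntegrable_indicator_of_bound {U : Set E} (hU : MeasurableSet U) {h : E → ℝ}
    (hm : AEStronglyMeasurable h (volume.restrict U)) {B : ℝ} (hB : ∀ᵐ t, t ∈ U → |h t| ≤ B) :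
    LocallyIntegrable (U.indicator h) volume := by
  refine (locallyIntegrable_const (μ := (volume : Measure E)) B).mono
    ((aestronglyMeasurable_indicator_iff hU).2 hm) ?_
  filter_upwards [hB] with t ht
  by_cases htU : t ∈ U
  · simpa [htU] using (ht htU).trans (le_abs_self B)
  · simp [htU]

theorem exists_smooth_approximation {ι : Type*} [Finite ι] {U K : Set E} (hU : IsOpen U)
    (hK : IsCompact K) (hKU : K ⊆ U) {r : E → ℝ} (hr : ContinuousOn r U) {a b : ℝ}
    (hab : ∀ y ∈ U, r y ∈ Set.Icc a b) (v : ι → E) {g : ι → E → ℝ} {B : ℝ}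
    (hgm : ∀ i, AEStronglyMeasurable (g i) (volume.restrict U))
    (hgB : ∀ i, ∀ᵐ y, y ∈ U → |g i y| ≤ B)
    (hw : ∀ i, ∀ η : E → ℝ, ContDiff ℝ ∞ η → HasCompactSupport η → tsupport η ⊆ U →
      ∫ y in U, r y * fderiv ℝ η y (v i) = -∫ y in U, g i y * η y) :
    ∃ R : ℕ → E → ℝ, (∀ j, ContDiff ℝ ∞ (R j)) ∧
      (∀ j, ∀ y ∈ K, R j y ∈ Set.Icc a b) ∧
      (∀ j, ∀ y ∈ K, ∀ i, |fderiv ℝ (R j) y (v i)| ≤ B) ∧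
      ∀ᵐ y, y ∈ K → Tendsto (fun j => R j y) atTop (𝓝 (r y)) ∧
        ∀ i, Tendsto (fun j => fderiv ℝ (R j) y (v i)) atTop (𝓝 (g i y)) := by
  obtain ⟨δ, hδ, hδU⟩ := hK.exists_thickening_subset_open hU hKU
  have hcb : ∀ s < δ, ∀ y ∈ K, closedBall y s ⊆ U := fun s hs y hy =>
    (closedBall_subset_ball hs).trans ((ball_subset_thickening hy δ).trans hδU)
  have hpos : ∀ j : ℕ, 0 < δ / (2 * (j + 2)) := fun j => by positivity
  -- The outer radius is `δ / (j + 2)`, strictly below `δ` even for `j = 0`. The fixed ratio `rOut =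
  -- 2 rIn` is what almost everywhere convergence of the convolutions requires.
  let φ : ℕ → ContDiffBump (0 : E) := fun j =>
    ⟨δ / (2 * (j + 2)), 2 * (δ / (2 * (j + 2))), hpos j, by linarith [hpos j]⟩
  have hφout : ∀ j, (φ j).rOut = 2 * (δ / (2 * (j + 2))) := fun j => rfl
  have hφlt : ∀ j, (φ j).rOut < δ := by
    intro j
    rw [hφout, mul_div_assoc', div_lt_iff₀ (by positivity)]
    nlinarith [Nat.cast_nonneg (α := ℝ) j]
  have hφlim : Tendsto (fun j => (φ j).rOut) atTop (𝓝 0) := by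
    have h1 : Tendsto (fun j : ℕ => (2 : ℝ) * ((j : ℝ) + 2)) atTop atTop :=
      (tendsto_atTop_add_const_right _ _ tendsto_natCast_atTop_atTop).const_mul_atTop two_pos
    simpa using (h1.const_div_atTop δ).const_mul 2
  have hφK : ∀ᶠ j in atTop, (φ j).rOut ≤ 2 * (φ j).rIn := Eventually.of_forall fun j => le_rfl
  have hrB : ∀ᵐ t, t ∈ U → |r t| ≤ max |a| |b| := ae_of_all _ fun t ht =>
    abs_le_max_abs_abs (hab t ht).1 (hab t ht).2
  have hrI : LocallyIntegrable (U.indicator r) volume :=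
    locallyIntegrable_indicator_of_bound hU.measurableSet
      (hr.aestronglyMeasurable hU.measurableSet) hrB
  have hgI : ∀ i, LocallyIntegrable (U.indicator (g i)) volume := fun i =>
    locallyIntegrable_indicator_of_bound hU.measurableSet (hgm i) (hgB i)
  have hder : ∀ j, ∀ y ∈ K, ∀ i, fderiv ℝ (mollify (φ j) (U.indicator r)) y (v i) =
      mollify (φ j) (U.indicator (g i)) y := fun j y hy i =>
    fderiv_mollify (φ j) hU.measurableSet hrI (hw i) (hcb _ (hφlt j) y hy)
  refine ⟨fun j => mollify (φ j) (U.indicator r), fun j => contDiff_mollify _ hrI,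
    fun j y hy => ?_, fun j y hy i => ?_, ?_⟩
  · refine mollify_mem_Icc (φ j) hrI (ball_subset_closedBall.trans (hcb _ (hφlt j) y hy))
      (ae_of_all _ fun t ht => ?_)
    rw [Set.indicator_of_mem ht]
    exact hab t ht
  · rw [hder j y hy i, abs_le]
    refine mollify_mem_Icc (φ j) (hgI i) (ball_subset_closedBall.trans (hcb _ (hφlt j) y hy)) ?_
    filter_upwards [hgB i] with t ht htU
    rw [Set.indicator_of_mem htU]
    exact abs_le.1 (ht htU)
  · have h1 := ContDiffBump.ae_convolution_tendsto_right_of_locallyIntegrable (μ := volume)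
      hφlim hφK hrI
    have h2 := ae_all_iff.2 fun i =>
      ContDiffBump.ae_convolution_tendsto_right_of_locallyIntegrable (μ := volume)
        hφlim hφK (hgI i)
    filter_upwards [h1, h2] with y hy1 hy2 hyK
    rw [Set.indicator_of_mem (hKU hyK)] at hy1
    refine ⟨hy1, fun i => ?_⟩
    have h3 := hy2 i
    rw [Set.indicator_of_mem (hKU hyK)] at h3
    exact h3.congr fun j => (hder j y hyK i).symm

end Mollification

/-! ### Continuity and measurability of gradient expressions -/

section Gradient

open Filter Topology

variable {n : ℕ} {M : Type*} [TopologicalSpace M] [ChartedSpace (EuclideanSpace ℝ (Fin n)) M]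
  [RiemannianBundle (fun x : M => TangentSpace (𝓡 n) x)]

local notation "𝔼" => EuclideanSpace ℝ (Fin n)

theorem grad_eq_zero_of_notMem_tsupport {f : M → ℝ} {x : M} (hx : x ∉ tsupport f) :
    grad (n := n) f x = 0 := by
  refine ext_inner_right ℝ fun X => ?_
  have h : f =ᶠ[𝓝 x] fun _ => (0 : ℝ) := notMem_tsupport_iff_eventuallyEq.1 hx
  have h0 : mvfderiv (𝓡 n) f x = 0 := by
    rw [mvfderiv, h.mfderiv_eq, mfderiv_const]
    exact ContinuousLinearMap.comp_zero _
  rw [inner_grad, h0, inner_zero_left]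
  rfl

variable [IsManifold (𝓡 n) ∞ M] [IsContMDiffRiemannianBundle (𝓡 n) ∞ (EuclideanSpace ℝ (Fin n))
  (fun x : M => TangentSpace (𝓡 n) x)]

theorem continuousOn_inv_metricMatrix (p : M) :
    ContinuousOn (fun y => (metricMatrix (chartAt 𝔼 p) y)⁻¹) (chartAt 𝔼 p).target := by
  simp only [Matrix.inv_def, Ring.inverse_eq_inv']
  have hc := continuousOn_metricMatrix (n := n) p
  refine ContinuousOn.smul (ContinuousOn.inv₀ ?_ fun y hy => (metricMatrix_posDef p hy).det_pos.ne')
    ?_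
  · exact (Continuous.matrix_det continuous_id).comp_continuousOn hc
  · exact (Continuous.matrix_adjugate continuous_id).comp_continuousOn hc

theorem continuousOn_inv_metricMatrix_apply (p : M) (i k : Fin n) :
    ContinuousOn (fun y => (metricMatrix (chartAt 𝔼 p) y)⁻¹ i k) (chartAt 𝔼 p).target :=
  continuousOn_pi.1 (continuousOn_pi.1 (continuousOn_inv_metricMatrix p) i) k

theorem continuous_norm_grad {f : M → ℝ} (hf : ContMDiff (𝓡 n) 𝓘(ℝ, ℝ) ∞ f) :
    Continuous fun x => ‖grad (n := n) f x‖ := by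
  suffices h : Continuous fun x => (inner ℝ (grad (n := n) f x) (grad f x) : ℝ) by
    exact (Real.continuous_sqrt.comp h).congr fun x => (norm_eq_sqrt_real_inner _).symm
  refine continuous_iff_continuousAt.2 fun p => ?_
  have hfd := (contDiffOn_comp_chartAt_symm p hf).continuousOn_fderiv_of_isOpen
    (chartAt 𝔼 p).open_target (by simp)
  have hfi : ∀ i, ContinuousOn (fun y => fderiv ℝ (fun z => f ((chartAt 𝔼 p).symm z)) y
      (EuclideanSpace.single i 1)) (chartAt 𝔼 p).target := fun i =>
    hfd.clm_apply continuousOn_const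
  have hQ : ContinuousOn (fun y => ∑ i, (∑ k, (metricMatrix (chartAt 𝔼 p) y)⁻¹ i k *
      fderiv ℝ (fun z => f ((chartAt 𝔼 p).symm z)) y (EuclideanSpace.single k 1)) *
      fderiv ℝ (fun z => f ((chartAt 𝔼 p).symm z)) y (EuclideanSpace.single i 1))
      (chartAt 𝔼 p).target :=
    continuousOn_finsetSum _ fun i _ => (continuousOn_finsetSum _ fun k _ =>
      (continuousOn_inv_metricMatrix_apply p i k).mul (hfi k)).mul (hfi i)
  have hc : ContinuousOn (fun x => (inner ℝ (grad (n := n) f x) (grad f x) : ℝ))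
      (chartAt 𝔼 p).source := by
    refine (hQ.comp (chartAt 𝔼 p).continuousOn fun x hx => (chartAt 𝔼 p).map_source hx).congr
      fun x hx => ?_
    obtain ⟨y, hy, rfl⟩ : ∃ y ∈ (chartAt 𝔼 p).target, (chartAt 𝔼 p).symm y = x :=
      ⟨_, (chartAt 𝔼 p).map_source hx, (chartAt 𝔼 p).left_inv hx⟩
    simp only [Function.comp_apply]
    rw [inner_eq_covector p hy, covector_grad p hy (hf.mdifferentiableAt (by simp)),
      (chartAt 𝔼 p).right_inv hy]
    rfl
  exact hc.continuousAt ((chartAt 𝔼 p).open_source.mem_nhds (mem_chart_source 𝔼 p))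

variable [SecondCountableTopology M] [Nonempty M] [MeasurableSpace M] [BorelSpace M]

/-- The field `G` is known to be measurable only through its chart components, so the pairing is
expanded with the inverse metric in each chart. -/
theorem aestronglyMeasurable_inner_grad {ρ : M → ℝ} {G : ∀ x : M, TangentSpace (𝓡 n) x}
    (hG : IsWeakGradient ρ G) {f : M → ℝ} (hf : ContMDiff (𝓡 n) 𝓘(ℝ, ℝ) ∞ f) :
    AEStronglyMeasurable (fun x => (inner ℝ (G x) (grad f x) : ℝ)) (riemannianVolume n M) := by
  refine aestronglyMeasurable_of_charts fun p => ?_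
  have htm := (chartAt 𝔼 p).open_target.measurableSet
  have hfd := (contDiffOn_comp_chartAt_symm p hf).continuousOn_fderiv_of_isOpen
    (chartAt 𝔼 p).open_target (by simp)
  have hfi : ∀ i, ContinuousOn (fun y => fderiv ℝ (fun z => f ((chartAt 𝔼 p).symm z)) y
      (EuclideanSpace.single i 1)) (chartAt 𝔼 p).target := fun i =>
    hfd.clm_apply continuousOn_const
  have hQ : AEStronglyMeasurable (fun y => ∑ i, (∑ k, (metricMatrix (chartAt 𝔼 p) y)⁻¹ i k *
      covector (chartAt 𝔼 p) y (G _) k) *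
      fderiv ℝ (fun z => f ((chartAt 𝔼 p).symm z)) y (EuclideanSpace.single i 1))
      (volume.restrict (chartAt 𝔼 p).target) := by
    refine Finset.aestronglyMeasurable_fun_sum _ fun i _ => AEStronglyMeasurable.mul
      (Finset.aestronglyMeasurable_fun_sum _ fun k _ => AEStronglyMeasurable.mul ?_ ?_) ?_
    · exact (continuousOn_inv_metricMatrix_apply p i k).aestronglyMeasurable htm
    · exact (hG.locallyIntegrableOn_grad p (EuclideanSpace.single k 1)).aestronglyMeasurable
    · exact (hfi i).aestronglyMeasurable htm
  refine hQ.congr ?_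
  filter_upwards [ae_restrict_mem htm] with y hy
  rw [inner_eq_covector p hy, covector_grad p hy (hf.mdifferentiableAt (by simp))]
  rfl

end Gradient

/-! ### Smooth approximation of `ρ` in a chart -/

section LocalExtension

open Filter Topology

theorem abs_mulVec_dotProduct_le {m : ℕ} (A : Matrix (Fin m) (Fin m) ℝ) {c d : Fin m → ℝ} {B : ℝ}
    (hB : 0 ≤ B) (hc : ∀ i, |c i| ≤ B) (hd : ∀ i, |d i| ≤ B) :
    |A.mulVec c ⬝ᵥ d| ≤ (∑ i, ∑ k, |A i k|) * (B * B) := by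
  simp only [dotProduct, Matrix.mulVec, Finset.sum_mul]
  refine (Finset.abs_sum_le_sum_abs _ _).trans (Finset.sum_le_sum fun i _ => ?_)
  refine (Finset.abs_sum_le_sum_abs _ _).trans (Finset.sum_le_sum fun k _ => ?_)
  rw [abs_mul, abs_mul, mul_assoc]
  exact mul_le_mul_of_nonneg_left (mul_le_mul (hc k) (hd i) (abs_nonneg _) hB) (abs_nonneg _)

theorem continuous_mul_of_tsupport_subset {X : Type*} [TopologicalSpace X] {f h : X → ℝ}
    {O : Set X} (hO : IsOpen O) (hf : ContinuousOn f O) (hh : Continuous h)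
    (hs : tsupport h ⊆ O) : Continuous fun x => f x * h x := by
  refine continuous_of_tsupport fun x hx => ?_
  have hxO : x ∈ O := hs (closure_mono (Function.support_mul_subset_right f h) hx)
  exact (hf.continuousAt (hO.mem_nhds hxO)).mul hh.continuousAt

variable {n : ℕ} {M : Type*} [TopologicalSpace M] [ChartedSpace (EuclideanSpace ℝ (Fin n)) M]
  [IsManifold (𝓡 n) ∞ M] [RiemannianBundle (fun x : M => TangentSpace (𝓡 n) x)]
  [IsContMDiffRiemannianBundle (𝓡 n) ∞ (EuclideanSpace ℝ (Fin n))
    (fun x : M => TangentSpace (𝓡 n) x)]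
  [SecondCountableTopology M] [Nonempty M] [MeasurableSpace M] [BorelSpace M]

local notation "𝔼" => EuclideanSpace ℝ (Fin n)

/-- By Cauchy–Schwarz `|⟨G, ∂_i⟩| ≤ N √g_ii` almost everywhere, which is bounded on compact sets;
mollification in coordinates keeps this bound. The uniform bounds `a`, `b`, `D` are there to supply
dominating functions. -/
theorem exists_smooth_approximation_chart [T2Space M] {ρ N : M → ℝ} (hρ : Continuous ρ)
    (hN : Continuous N)
    {G : ∀ x : M, TangentSpace (𝓡 n) x} (hG : IsWeakGradient ρ G)
    (hGN : ∀ᵐ x ∂riemannianVolume n M, ‖G x‖ = N x) (p : M) {S : Set M} (hS : IsCompact S)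
    (hSp : S ⊆ (chartAt 𝔼 p).source) (hSρ : ∀ x ∈ S, 0 < ρ x) :
    ∃ (R : ℕ → 𝔼 → ℝ) (a b D : ℝ), 0 < a ∧ (∀ j, ContDiff ℝ ∞ (R j)) ∧
      (∀ j, ∀ x ∈ S, R j (chartAt 𝔼 p x) ∈ Set.Icc a b) ∧
      ∀ᵐ x ∂riemannianVolume n M, x ∈ S →
        Tendsto (fun j => R j (chartAt 𝔼 p x)) atTop (𝓝 (ρ x)) ∧
        (∀ j, |(inner ℝ (G x) (grad (fun z => R j (chartAt 𝔼 p z)) x) : ℝ)| ≤ D) ∧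
        Tendsto (fun j => (inner ℝ (G x) (grad (fun z => R j (chartAt 𝔼 p z)) x) : ℝ)) atTop
          (𝓝 (‖G x‖ ^ 2)) := by
  set e := chartAt 𝔼 p with he
  set r : 𝔼 → ℝ := fun y => ρ (e.symm y) with hr
  have hrc : ContinuousOn r e.target := hρ.comp_continuousOn e.continuousOn_symm
  have hO : IsOpen (e.target ∩ r ⁻¹' Set.Ioi 0) := hrc.isOpen_inter_preimage e.open_target isOpen_Ioi
  have hK : IsCompact (e '' S) := hS.image_of_continuousOn (e.continuousOn.mono hSp)
  have hKO : e '' S ⊆ e.target ∩ r ⁻¹' Set.Ioi 0 := by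
    rintro _ ⟨x, hx, rfl⟩
    refine ⟨e.map_source (hSp hx), ?_⟩
    simp only [hr, Set.mem_preimage, Set.mem_Ioi, e.left_inv (hSp hx)]
    exact hSρ x hx
  -- The compact `K₁` leaves room to mollify around the image of `S`, while `ρ` stays bounded away
  -- from `0` and all coefficients stay bounded on it.
  obtain ⟨K₁, hK₁, hKK₁, hK₁O⟩ := exists_compact_between hK hO hKO
  have hK₁t : K₁ ⊆ e.target := fun y hy => (hK₁O hy).1
  have hUt : interior K₁ ⊆ e.target := interior_subset.trans hK₁t
  obtain ⟨a, ha, haK⟩ := hK₁.exists_forall_le' (hrc.mono hK₁t) (a := 0) fun y hy => (hK₁O hy).2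
  obtain ⟨b, hbK⟩ := hK₁.exists_bound_of_continuousOn (hrc.mono hK₁t)
  -- bounds on the components of the weak gradient
  set v : Fin n → 𝔼 := fun i => EuclideanSpace.single i 1 with hv
  set g : Fin n → 𝔼 → ℝ := fun i y => inner ℝ (G (e.symm y)) (chartVector e y (v i)) with hg
  have hgc : ContinuousOn (fun y => N (e.symm y) * ∑ i, Real.sqrt (metricMatrix e y i i))
      K₁ := by
    refine ((hN.comp_continuousOn e.continuousOn_symm).mono hK₁t).mul
      (continuousOn_finsetSum _ fun i _ => ?_)
    exact Real.continuous_sqrt.comp_continuousOn ((continuousOn_pi.1 (continuousOn_pi.1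
      (continuousOn_metricMatrix p) i) i).mono hK₁t)
  obtain ⟨B₀, hB₀⟩ := hK₁.exists_bound_of_continuousOn hgc
  set B := max B₀ 0 with hB
  have hB0 : 0 ≤ B := le_max_right _ _
  have hGe : ∀ᵐ y ∂(volume : Measure 𝔼), y ∈ e.target → ‖G (e.symm y)‖ = N (e.symm y) :=
    (ae_restrict_iff' e.open_target.measurableSet).1 (ae_chart_of_ae (p := p) hGN)
  have hgB : ∀ᵐ y ∂(volume : Measure 𝔼), y ∈ interior K₁ → ∀ i, |g i y| ≤ B := by
    filter_upwards [hGe] with y hy hyU i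
    have hyK := interior_subset hyU
    have hsq : ‖chartVector e y (v i)‖ = Real.sqrt (metricMatrix e y i i) := by
      rw [norm_eq_sqrt_real_inner]; rfl
    have hNn : 0 ≤ N (e.symm y) := by rw [← hy (hUt hyU)]; exact norm_nonneg _
    calc |g i y| ≤ ‖G (e.symm y)‖ * ‖chartVector e y (v i)‖ := abs_real_inner_le_norm _ _
      _ ≤ N (e.symm y) * ∑ i, Real.sqrt (metricMatrix e y i i) := by
        rw [hy (hUt hyU), hsq]
        exact mul_le_mul_of_nonneg_left (Finset.single_le_sum
          (f := fun i => Real.sqrt (metricMatrix e y i i)) (fun i _ => Real.sqrt_nonneg _)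
          (Finset.mem_univ i)) hNn
      _ ≤ B := ((le_abs_self _).trans (hB₀ y hyK)).trans (le_max_left _ _)
  have hgm : ∀ i, AEStronglyMeasurable (g i) (volume.restrict (interior K₁)) := fun i =>
    (hG.locallyIntegrableOn_grad p (v i)).aestronglyMeasurable.mono_measure
      (Measure.restrict_mono hUt le_rfl)
  have hw : ∀ i, ∀ η : 𝔼 → ℝ, ContDiff ℝ ∞ η → HasCompactSupport η → tsupport η ⊆ interior K₁ →
      ∫ y in interior K₁, r y * fderiv ℝ η y (v i) = -∫ y in interior K₁, g i y * η y := by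
    intro i η hη hηc hηs
    have h := hG.integral_eq p (v i) η hη hηc (hηs.trans hUt)
    have hz : ∀ y ∈ e.target \ interior K₁, y ∉ tsupport η := fun y hy h => hy.2 (hηs h)
    -- Both integrands vanish off the support of `η`, so the weak derivative identity on the chart
    -- target restricts to the interior of `K₁`.
    rw [setIntegral_eq_of_subset_of_forall_sdiff_eq_zero e.open_target.measurableSet hUt
      (fun y hy => by
        have h0 : fderiv ℝ η y = 0 := by
          by_contra hne
          exact hz y hy (support_fderiv_subset ℝ hne)
        rw [h0]; simp),
      setIntegral_eq_of_subset_of_forall_sdiff_eq_zero e.open_target.measurableSet hUt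
      (fun y hy => by rw [image_eq_zero_of_notMem_tsupport (hz y hy), mul_zero])] at h
    exact h
  obtain ⟨R, hRs, hRab, hRB, hRlim⟩ := exists_smooth_approximation isOpen_interior hK hKK₁
    (hrc.mono hUt) (a := a) (b := b)
    (fun y hy => ⟨haK y (interior_subset hy), (le_abs_self _).trans (hbK y (interior_subset hy))⟩) v
    hgm (fun i => hgB.mono fun y hy hyU => hy hyU i) hw
  have hinvc : ContinuousOn (fun y => ∑ i, ∑ k, |(metricMatrix e y)⁻¹ i k|) K₁ :=
    (continuousOn_finsetSum _ fun i _ => continuousOn_finsetSum _ fun k _ =>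
      (continuousOn_inv_metricMatrix_apply p i k).abs).mono hK₁t
  obtain ⟨D, hD⟩ := hK₁.exists_bound_of_continuousOn hinvc
  refine ⟨R, a, b, D * (B * B), ha, hRs, fun j x hx => hRab j _ ⟨x, hx, rfl⟩, ?_⟩
  have hcov : ∀ j, ∀ y ∈ e.target, covector e y (grad (fun z => R j (e z)) (e.symm y)) =
      fun i => fderiv ℝ (R j) y (v i) := by
    intro j y hy
    have hmd : MDifferentiableAt (𝓡 n) 𝓘(ℝ, ℝ) (fun z => R j (e z)) (e.symm y) :=
      MDifferentiableAt.comp (e.symm y)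
        ((hRs j).contMDiff.mdifferentiableAt (by simp))
        (mdifferentiableAt_atlas (I := 𝓡 n) (chart_mem_atlas 𝔼 p) (e.map_target hy))
    rw [he, covector_grad p hy hmd]
    ext i
    have heq : (fun z => R j (e (e.symm z))) =ᶠ[𝓝 y] R j := by
      filter_upwards [e.open_target.mem_nhds hy] with z hz
      rw [e.right_inv hz]
    rw [← he, heq.fderiv_eq]
  have hchart : ∀ᵐ x ∂riemannianVolume n M, x ∈ e.source → (x ∈ S →
      Tendsto (fun j => R j (e x)) atTop (𝓝 (ρ x)) ∧
        (∀ j, |(inner ℝ (G x) (grad (fun z => R j (e z)) x) : ℝ)| ≤ D * (B * B)) ∧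
        Tendsto (fun j => (inner ℝ (G x) (grad (fun z => R j (e z)) x) : ℝ)) atTop
          (𝓝 (‖G x‖ ^ 2))) := by
    refine ae_source_of_ae_chart ?_
    rw [ae_restrict_iff' e.open_target.measurableSet]
    filter_upwards [hRlim, hgB] with y hy hyB hyt hyS
    have hyK : y ∈ e '' S := ⟨_, hyS, e.right_inv hyt⟩
    have hyU := hKK₁ hyK
    obtain ⟨h1, h2⟩ := hy hyK
    have hinner : ∀ j, (inner ℝ (G (e.symm y)) (grad (fun z => R j (e z)) (e.symm y)) : ℝ) =
        ((metricMatrix e y)⁻¹).mulVec (covector e y (G (e.symm y))) ⬝ᵥ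
          fun i => fderiv ℝ (R j) y (v i) := by
      intro j
      rw [he, inner_eq_covector p hyt, ← he, hcov j y hyt]
    refine ⟨by rw [e.right_inv hyt]; exact h1, fun j => ?_, ?_⟩
    · rw [hinner]
      refine (abs_mulVec_dotProduct_le _ hB0 (hyB hyU) (hRB j y hyK)).trans ?_
      exact mul_le_mul_of_nonneg_right ((le_abs_self _).trans (hD y (interior_subset hyU)))
        (mul_nonneg hB0 hB0)
    · refine Tendsto.congr (fun j => (hinner j).symm) ?_
      -- The partial derivatives of `R j` converge to the lowered components of `G`, so the limit of
      -- the pairing is `⟨G, G⟩`.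
      rw [← real_inner_self_eq_norm_sq, he, inner_eq_covector p hyt, ← he]
      exact tendsto_finsetSum _ fun i _ => tendsto_const_nhds.mul (h2 i)
  filter_upwards [hchart] with x hx hxS
  exact hx (hSp hxS) hxS

end LocalExtension

/-! ### Testing the divergence inequality with functions of `ρ` -/

section Extension

open Filter Topology

variable {n : ℕ} {M : Type*} [TopologicalSpace M] [ChartedSpace (EuclideanSpace ℝ (Fin n)) M]
  [IsManifold (𝓡 n) ∞ M] [RiemannianBundle (fun x : M => TangentSpace (𝓡 n) x)]
  [IsContMDiffRiemannianBundle (𝓡 n) ∞ (EuclideanSpace ℝ (Fin n))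
    (fun x : M => TangentSpace (𝓡 n) x)]
  [T2Space M] [SecondCountableTopology M] [Nonempty M] [MeasurableSpace M] [BorelSpace M]

local notation "𝔼" => EuclideanSpace ℝ (Fin n)

theorem integrable_of_continuousOn_compact {f : M → ℝ} {S : Set M} (hS : IsCompact S)
    (hf : ContinuousOn f S) (hz : ∀ x ∉ S, f x = 0) : Integrable f (riemannianVolume n M) := by
  have := isLocallyFiniteMeasure_riemannianVolume (n := n) (M := M)
  rw [← integrableOn_iff_integrable_of_support_subset (s := S)
    fun x hx => by by_contra h; exact hx (hz x h)]
  exact hf.integrableOn_compact hS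

/-- The cutoff may come from either factor: in some uses `f` has compact support, in others `f = u`
does not and the coefficient `k` carries the test function. -/
theorem integrable_mul_inner_grad {ρ N : M → ℝ} (hN : Continuous N)
    {G : ∀ x : M, TangentSpace (𝓡 n) x} (hG : IsWeakGradient ρ G)
    (hGN : ∀ᵐ x ∂riemannianVolume n M, ‖G x‖ = N x) {k f : M → ℝ}
    (hf : ContMDiff (𝓡 n) 𝓘(ℝ, ℝ) ∞ f) {S : Set M} (hS : IsCompact S) (hk : ContinuousOn k S)
    (hz : ∀ x ∉ S, k x = 0 ∨ grad (n := n) f x = 0) :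
    Integrable (fun x => k x * (inner ℝ (G x) (grad f x) : ℝ)) (riemannianVolume n M) := by
  have := isLocallyFiniteMeasure_riemannianVolume (n := n) (M := M)
  rw [← integrableOn_iff_integrable_of_support_subset (s := S) fun x hx => by
    by_contra h
    rcases hz x h with h0 | h0 <;> simp [h0] at hx]
  have hc : ContinuousOn (fun x => k x * (N x * ‖grad (n := n) f x‖)) S :=
    hk.mul (hN.mul (continuous_norm_grad hf)).continuousOn
  obtain ⟨B, hB⟩ := hS.exists_bound_of_continuousOn hc
  refine Integrable.mono' (g := fun _ => B) (integrableOn_const hS.measure_lt_top.ne)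
    ((hk.aestronglyMeasurable hS.measurableSet).mul
      (aestronglyMeasurable_inner_grad hG hf).restrict) ?_
  filter_upwards [ae_restrict_mem hS.measurableSet, ae_restrict_of_ae hGN] with x hx hxN
  refine le_trans ?_ (hB x hx)
  rw [norm_mul, norm_mul]
  refine mul_le_mul_of_nonneg_left ?_ (norm_nonneg _)
  rw [← hxN]
  exact (abs_real_inner_le_norm _ _).trans (le_abs_self _)

/-- Formally this is `H` with `η = F(ρ) ψ`. The admissible functions `F(R_j) ψ` are used instead,
nonnegative because `F` and `ψ` are, and dominated convergence applies on both sides. -/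
theorem laplacian_inequality_comp_of_chart {ρ N w q : M → ℝ} (hρ : Continuous ρ)
    (hN : Continuous N) (hw : Continuous w) (hq : ContinuousOn q {x | 0 < ρ x})
    {G : ∀ x : M, TangentSpace (𝓡 n) x} (hG : IsWeakGradient ρ G)
    (hGN : ∀ᵐ x ∂riemannianVolume n M, ‖G x‖ = N x)
    (H : ∀ η : M → ℝ, ContMDiff (𝓡 n) 𝓘(ℝ, ℝ) ∞ η → HasCompactSupport η →
      tsupport η ⊆ {x | 0 < ρ x} → (∀ x, 0 ≤ η x) →
      ∫ x, q x * η x ∂riemannianVolume n M ≤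
        -∫ x, w x * inner ℝ (G x) (grad η x) ∂riemannianVolume n M)
    {F : ℝ → ℝ} (hF : ContDiffOn ℝ ∞ F (Set.Ioi 0)) (hF0 : ∀ t, 0 < t → 0 ≤ F t)
    (p : M) {ψ : M → ℝ} (hψ : ContMDiff (𝓡 n) 𝓘(ℝ, ℝ) ∞ ψ) (hψc : HasCompactSupport ψ)
    (hψρ : tsupport ψ ⊆ {x | 0 < ρ x}) (hψ0 : ∀ x, 0 ≤ ψ x)
    (hψp : tsupport ψ ⊆ (chartAt 𝔼 p).source) :
    ∫ x, q x * (F (ρ x) * ψ x) ∂riemannianVolume n M ≤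
      -∫ x, w x * (F (ρ x) * inner ℝ (G x) (grad ψ x) + deriv F (ρ x) * ψ x * ‖G x‖ ^ 2)
        ∂riemannianVolume n M := by
  have := isLocallyFiniteMeasure_riemannianVolume (n := n) (M := M)
  set S := tsupport ψ with hS
  have hSc : IsCompact S := hψc
  obtain ⟨R, a, b, D, ha, hRs, hRab, hae⟩ :=
    exists_smooth_approximation_chart hρ hN hG hGN p hSc hψp hψρ
  have hpos : ∀ j, ∀ x ∈ S, 0 < R j (chartAt 𝔼 p x) := fun j x hx =>
    ha.trans_le (hRab j x hx).1
  have hIcc : Set.Icc a b ⊆ Set.Ioi 0 := fun t ht => ha.trans_le ht.1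
  have hdF : ContinuousOn (deriv F) (Set.Ioi 0) :=
    hF.continuousOn_deriv_of_isOpen isOpen_Ioi (by simp)
  -- All values of `R j` on `S` lie in `[a, b]` with `a > 0`, so `F` and `F'` are bounded there
  -- uniformly in `j`.
  obtain ⟨B₀, hB₀⟩ := isCompact_Icc.exists_bound_of_continuousOn (hF.continuousOn.mono hIcc)
  obtain ⟨B₁, hB₁⟩ := isCompact_Icc.exists_bound_of_continuousOn (hdF.mono hIcc)
  set f : ℕ → M → ℝ := fun j x => F (R j (chartAt 𝔼 p x)) * ψ x with hf
  have hfs : ∀ j, ContMDiff (𝓡 n) 𝓘(ℝ, ℝ) ∞ (f j) := fun j =>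
    contMDiff_comp_chartAt_mul p hF (hRs j) hψ hψp (hpos j)
  have hfsupp : ∀ j, tsupport (f j) ⊆ S := fun j =>
    closure_mono (Function.support_mul_subset_right _ ψ)
  have hfc : ∀ j, HasCompactSupport (f j) := fun j => hψc.mul_left
  have hf0 : ∀ j x, 0 ≤ f j x := by
    intro j x
    by_cases hx : x ∈ S
    · exact mul_nonneg (hF0 _ (hpos j x hx)) (hψ0 x)
    · simp [hf, image_eq_zero_of_notMem_tsupport hx]
  have hineq := fun j => H (f j) (hfs j) (hfc j) ((hfsupp j).trans hψρ) (hf0 j)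
  have hzψ : ∀ x ∉ S, ψ x = 0 := fun x hx => image_eq_zero_of_notMem_tsupport hx
  have hzg : ∀ x ∉ S, grad (n := n) ψ x = 0 := fun x hx => grad_eq_zero_of_notMem_tsupport hx
  have hzf : ∀ j, ∀ x ∉ S, grad (n := n) (f j) x = 0 := fun j x hx =>
    grad_eq_zero_of_notMem_tsupport fun h => hx (hfsupp j h)
  -- the product rule for `f j`
  have hgrad : ∀ j, ∀ x ∈ S, (inner ℝ (G x) (grad (f j) x) : ℝ) =
      F (R j (chartAt 𝔼 p x)) * inner ℝ (G x) (grad ψ x) +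
        deriv F (R j (chartAt 𝔼 p x)) * ψ x *
          inner ℝ (G x) (grad (fun z => R j (chartAt 𝔼 p z)) x) := by
    intro j x hx
    have hmd : MDifferentiableAt (𝓡 n) 𝓘(ℝ, ℝ) (fun z => R j (chartAt 𝔼 p z)) x :=
      MDifferentiableAt.comp x ((hRs j).contMDiff.mdifferentiableAt (by simp))
        (mdifferentiableAt_atlas (I := 𝓡 n) (chart_mem_atlas 𝔼 p) (hψp hx))
    have hFd : DifferentiableAt ℝ F (R j (chartAt 𝔼 p x)) :=
      (hF.contDiffAt (Ioi_mem_nhds (hpos j x hx))).differentiableAt (by simp)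
    have hmF : MDifferentiableAt (𝓡 n) 𝓘(ℝ, ℝ) (fun z => F (R j (chartAt 𝔼 p z))) x :=
      MDifferentiableAt.comp (I' := 𝓘(ℝ, ℝ)) x hFd.mdifferentiableAt hmd
    rw [hf, grad_mul hmF (hψ.mdifferentiableAt (by simp)), 
      grad_comp (f := fun z => R j (chartAt 𝔼 p z)) hFd.hasDerivAt hmd,
      inner_add_right, real_inner_smul_right, real_inner_smul_right, real_inner_smul_right]
    ring
  -- convergence of the left-hand sides
  have hqS : ContinuousOn (fun x => |q x| * (B₀ * |ψ x|)) S :=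
    (hq.mono hψρ).abs.mul (continuousOn_const.mul hψ.continuous.abs.continuousOn)
  have hL : Tendsto (fun j => ∫ x, q x * f j x ∂riemannianVolume n M) atTop
      (𝓝 (∫ x, q x * (F (ρ x) * ψ x) ∂riemannianVolume n M)) := by
    refine tendsto_integral_of_dominated_convergence
      (S.indicator fun x => |q x| * (B₀ * |ψ x|)) (fun j => ?_) ?_ (fun j => ?_) ?_
    · exact (continuous_mul_of_tsupport_subset (isOpen_lt continuous_const hρ) hq
        (hfs j).continuous ((hfsupp j).trans hψρ)).aestronglyMeasurable
    · exact (hqS.integrableOn_compact hSc).integrable_indicator hSc.measurableSet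
    · refine ae_of_all _ fun x => ?_
      by_cases hx : x ∈ S
      · rw [Set.indicator_of_mem hx, norm_mul, hf, norm_mul]
        exact mul_le_mul_of_nonneg_left (mul_le_mul_of_nonneg_right (hB₀ _ (hRab j x hx))
          (abs_nonneg _)) (abs_nonneg _)
      · simp [hf, hx, hzψ x hx]
    · filter_upwards [hae] with x hx
      by_cases hxS : x ∈ S
      · have hFc : ContinuousAt F (ρ x) :=
          hF.continuousOn.continuousAt (Ioi_mem_nhds (hψρ hxS))
        exact ((hFc.tendsto.comp (hx hxS).1).mul_const _).const_mul _
      · simp [hf, hzψ x hxS]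
  -- convergence of the right-hand sides
  have hwS : Continuous fun x => |w x| * (B₀ * (N x * ‖grad (n := n) ψ x‖) + B₁ * |ψ x| * D) :=
    hw.abs.mul ((continuous_const.mul (hN.mul (continuous_norm_grad hψ))).add
      ((continuous_const.mul hψ.continuous.abs).mul continuous_const))
  have hR : Tendsto (fun j => ∫ x, w x * inner ℝ (G x) (grad (f j) x) ∂riemannianVolume n M)
      atTop (𝓝 (∫ x, w x * (F (ρ x) * inner ℝ (G x) (grad ψ x) +
        deriv F (ρ x) * ψ x * ‖G x‖ ^ 2) ∂riemannianVolume n M)) := by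
    refine tendsto_integral_of_dominated_convergence
      (S.indicator fun x => |w x| * (B₀ * (N x * ‖grad (n := n) ψ x‖) + B₁ * |ψ x| * D))
      (fun j => ?_) ?_ (fun j => ?_) ?_
    · exact hw.aestronglyMeasurable.mul (aestronglyMeasurable_inner_grad hG (hfs j))
    · exact (hwS.continuousOn.integrableOn_compact hSc).integrable_indicator hSc.measurableSet
    · filter_upwards [hae, hGN] with x hx hxN
      by_cases hxS : x ∈ S
      · have hb0 := hB₀ _ (hRab j x hxS)
        have hb1 := hB₁ _ (hRab j x hxS)
        rw [Set.indicator_of_mem hxS, norm_mul, hgrad j x hxS]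
        refine mul_le_mul_of_nonneg_left ((norm_add_le _ _).trans (add_le_add ?_ ?_))
          (abs_nonneg _)
        · rw [norm_mul, ← hxN]
          exact mul_le_mul hb0 (abs_real_inner_le_norm _ _) (norm_nonneg _)
            ((norm_nonneg _).trans hb0)
        · rw [norm_mul, norm_mul]
          exact mul_le_mul (mul_le_mul_of_nonneg_right hb1 (norm_nonneg _)) ((hx hxS).2.1 j)
            (norm_nonneg _) (mul_nonneg ((norm_nonneg _).trans hb1) (abs_nonneg _))
      · simp [hxS, hzf j x hxS]
    · filter_upwards [hae] with x hx
      by_cases hxS : x ∈ S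
      · have hmem : Set.Ioi 0 ∈ 𝓝 (ρ x) := Ioi_mem_nhds (hψρ hxS)
        have hFc : ContinuousAt F (ρ x) := hF.continuousOn.continuousAt hmem
        have hdFc : ContinuousAt (deriv F) (ρ x) := hdF.continuousAt hmem
        simp only [hgrad _ x hxS]
        exact (((hFc.tendsto.comp (hx hxS).1).mul_const _).add
          (((hdFc.tendsto.comp (hx hxS).1).mul_const _).mul (hx hxS).2.2)).const_mul _
      · simp [hzf _ x hxS, hzψ x hxS, hzg x hxS]
  exact le_of_tendsto_of_tendsto' hL hR.neg hineq

theorem integrable_comp_gradient_terms {ρ N w : M → ℝ} (hρ : Continuous ρ)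
    (hN : Continuous N) (hw : Continuous w)
    {G : ∀ x : M, TangentSpace (𝓡 n) x} (hG : IsWeakGradient ρ G)
    (hGN : ∀ᵐ x ∂riemannianVolume n M, ‖G x‖ = N x)
    {F : ℝ → ℝ} (hF : ContDiffOn ℝ ∞ F (Set.Ioi 0))
    {ψ : M → ℝ} (hψ : ContMDiff (𝓡 n) 𝓘(ℝ, ℝ) ∞ ψ) (hψc : HasCompactSupport ψ)
    (hψρ : tsupport ψ ⊆ {x | 0 < ρ x}) :
    Integrable (fun x => w x * (F (ρ x) * inner ℝ (G x) (grad ψ x) +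
      deriv F (ρ x) * ψ x * ‖G x‖ ^ 2)) (riemannianVolume n M) := by
  have hdF : ContinuousOn (deriv F) (Set.Ioi 0) :=
    hF.continuousOn_deriv_of_isOpen isOpen_Ioi (by simp)
  have h1 : Integrable (fun x => (w x * F (ρ x)) * (inner ℝ (G x) (grad ψ x) : ℝ))
      (riemannianVolume n M) :=
    integrable_mul_inner_grad hN hG hGN hψ hψc
      (hw.continuousOn.mul (hF.continuousOn.comp hρ.continuousOn hψρ))
      fun x hx => Or.inr (grad_eq_zero_of_notMem_tsupport hx)
  have h2 : Integrable (fun x => w x * (deriv F (ρ x) * ψ x * N x ^ 2))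
      (riemannianVolume n M) :=
    integrable_of_continuousOn_compact hψc
      (hw.continuousOn.mul (((hdF.comp hρ.continuousOn hψρ).mul hψ.continuous.continuousOn).mul
        (hN.pow 2).continuousOn))
      fun x hx => by simp [image_eq_zero_of_notMem_tsupport hx]
  refine (h1.add h2).congr ?_
  filter_upwards [hGN] with x hx
  simp only [Pi.add_apply, hx]
  ring

/-- Both sides are additive in `ψ`, and a partition of unity splits `ψ` into nonnegative pieces each
supported in one chart. -/
theorem laplacian_inequality_comp {ρ N w q : M → ℝ} (hρ : Continuous ρ)
    (hN : Continuous N) (hw : Continuous w) (hq : ContinuousOn q {x | 0 < ρ x})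
    {G : ∀ x : M, TangentSpace (𝓡 n) x} (hG : IsWeakGradient ρ G)
    (hGN : ∀ᵐ x ∂riemannianVolume n M, ‖G x‖ = N x)
    (H : ∀ η : M → ℝ, ContMDiff (𝓡 n) 𝓘(ℝ, ℝ) ∞ η → HasCompactSupport η →
      tsupport η ⊆ {x | 0 < ρ x} → (∀ x, 0 ≤ η x) →
      ∫ x, q x * η x ∂riemannianVolume n M ≤
        -∫ x, w x * inner ℝ (G x) (grad η x) ∂riemannianVolume n M)
    {F : ℝ → ℝ} (hF : ContDiffOn ℝ ∞ F (Set.Ioi 0)) (hF0 : ∀ t, 0 < t → 0 ≤ F t)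
    {ψ : M → ℝ} (hψ : ContMDiff (𝓡 n) 𝓘(ℝ, ℝ) ∞ ψ) (hψc : HasCompactSupport ψ)
    (hψρ : tsupport ψ ⊆ {x | 0 < ρ x}) (hψ0 : ∀ x, 0 ≤ ψ x) :
    ∫ x, q x * (F (ρ x) * ψ x) ∂riemannianVolume n M ≤
      -∫ x, w x * (F (ρ x) * inner ℝ (G x) (grad ψ x) + deriv F (ρ x) * ψ x * ‖G x‖ ^ 2)
        ∂riemannianVolume n M := by
  classical
  have hLC : LocallyCompactSpace M := ChartedSpace.locallyCompactSpace 𝔼 M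
  -- A finite cover indexes the partition of unity by a finite type, so the decomposition of `ψ` is
  -- a finite sum.
  obtain ⟨t, ht⟩ := hψc.isCompact.elim_finite_subcover
    (fun p : M => (chartAt 𝔼 p).source) (fun p => (chartAt 𝔼 p).open_source)
    fun x _ => Set.mem_iUnion.2 ⟨x, mem_chart_source 𝔼 x⟩
  obtain ⟨χ, hχ⟩ := SmoothPartitionOfUnity.exists_isSubordinate (𝓡 n)
    (isClosed_tsupport ψ) (fun p : t => (chartAt 𝔼 (p : M)).source)
    (fun p => (chartAt 𝔼 (p : M)).open_source) (by simpa [Set.iUnion_subtype] using ht)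
  set f : t → M → ℝ := fun i x => χ i x * ψ x with hf
  have hfs : ∀ i, ContMDiff (𝓡 n) 𝓘(ℝ, ℝ) ∞ (f i) := fun i => (χ i).contMDiff.mul hψ
  have hfsupp : ∀ i, tsupport (f i) ⊆ tsupport ψ := fun i =>
    closure_mono (Function.support_mul_subset_right _ ψ)
  have hfχ : ∀ i, tsupport (f i) ⊆ (chartAt 𝔼 (i : M)).source := fun i =>
    (closure_mono (Function.support_mul_subset_left _ _)).trans (hχ i)
  have hsum : ∀ x, ψ x = ∑ i, f i x := by
    intro x
    by_cases hx : x ∈ tsupport ψ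
    · have h1 := χ.sum_eq_one hx
      rw [finsum_eq_sum_of_fintype] at h1
      simp only [hf, ← Finset.sum_mul, h1, one_mul]
    · simp [hf, image_eq_zero_of_notMem_tsupport hx]
  have hqF : ∀ θ : M → ℝ, Continuous θ → HasCompactSupport θ → tsupport θ ⊆ {x | 0 < ρ x} →
      Integrable (fun x => q x * (F (ρ x) * θ x)) (riemannianVolume n M) := fun θ hθ hθc hθρ =>
    integrable_of_continuousOn_compact hθc ((hq.mono hθρ).mul
      ((hF.continuousOn.comp hρ.continuousOn hθρ).mul hθ.continuousOn))
      fun x hx => by simp [image_eq_zero_of_notMem_tsupport hx]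
  -- the inequality is additive in the test function
  have key : ∀ s : Finset t,
      ContMDiff (𝓡 n) 𝓘(ℝ, ℝ) ∞ (fun x => ∑ i ∈ s, f i x) ∧
      tsupport (fun x => ∑ i ∈ s, f i x) ⊆ tsupport ψ ∧
      ∫ x, q x * (F (ρ x) * ∑ i ∈ s, f i x) ∂riemannianVolume n M ≤
      -∫ x, w x * (F (ρ x) * inner ℝ (G x) (grad (fun x => ∑ i ∈ s, f i x) x) +
        deriv F (ρ x) * (∑ i ∈ s, f i x) * ‖G x‖ ^ 2) ∂riemannianVolume n M := by
    intro s
    induction s using Finset.induction_on with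
    | empty =>
      have hg0 : ∀ x : M, grad (n := n) (fun _ : M => (0 : ℝ)) x = 0 := fun x =>
        grad_eq_zero_of_notMem_tsupport (by simp [tsupport, Function.support])
      refine ⟨by simpa using contMDiff_const, by simp [tsupport, Function.support], ?_⟩
      simp [hg0]
    | insert i s hi ih =>
      obtain ⟨ih1, ih2, ih3⟩ := ih
      have hsupp : tsupport (fun x => f i x + ∑ j ∈ s, f j x) ⊆ tsupport ψ :=
        (tsupport_add (f i) _).trans (Set.union_subset (hfsupp i) ih2)
      simp only [Finset.sum_insert hi]
      refine ⟨(hfs i).add ih1, hsupp, ?_⟩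
      have hcs : ∀ θ : M → ℝ, tsupport θ ⊆ tsupport ψ → HasCompactSupport θ := fun θ hθ =>
        hψc.isCompact.of_isClosed_subset (isClosed_tsupport θ) hθ
      have hi3 := laplacian_inequality_comp_of_chart hρ hN hw hq hG hGN H hF hF0 (i : M) (hfs i)
        (hcs _ (hfsupp i)) ((hfsupp i).trans hψρ)
        (fun x => mul_nonneg (χ.nonneg i x) (hψ0 x)) (hfχ i)
      have hA := integral_add
        (hqF _ (hfs i).continuous (hcs _ (hfsupp i)) ((hfsupp i).trans hψρ))
        (hqF _ ih1.continuous (hcs _ ih2) (ih2.trans hψρ))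
      have hB := integral_add
        (integrable_comp_gradient_terms hρ hN hw hG hGN hF (hfs i) (hcs _ (hfsupp i))
          ((hfsupp i).trans hψρ))
        (integrable_comp_gradient_terms hρ hN hw hG hGN hF ih1 (hcs _ ih2) (ih2.trans hψρ))
      calc _ = ∫ x, (q x * (F (ρ x) * f i x) + q x * (F (ρ x) * ∑ j ∈ s, f j x))
            ∂riemannianVolume n M := by
            refine integral_congr_ae (ae_of_all _ fun x => ?_)
            simp only
            ring
        _ ≤ _ := by
            rw [hA]
            refine (add_le_add hi3 ih3).trans ?_
            rw [← neg_add, ← hB]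
            refine le_of_eq (congrArg Neg.neg (integral_congr_ae (ae_of_all _ fun x => ?_)))
            simp only
            rw [grad_add ((hfs i).mdifferentiableAt (by simp))
              (ih1.mdifferentiableAt (by simp)), inner_add_right]
            ring
  have := (key Finset.univ).2.2
  simp only [← hsum] at this
  exact this

end Extension

/-! ### The radial weight and its Riccati identity -/

section Weight

open Filter Topology

/-- The radial weight `t ^ α * κ t / (1 + t ^ 2)`. -/
def hardyWeight (α κ t : ℝ) : ℝ := t ^ α * (κ * t / (1 + t ^ 2))

theorem contDiffOn_hardyWeight (α κ : ℝ) : ContDiffOn ℝ ∞ (hardyWeight α κ) (Set.Ioi 0) := by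
  refine ContDiffOn.mul (fun t ht => ?_) ?_
  · exact (Real.contDiffAt_rpow_const_of_ne (ne_of_gt ht)).contDiffWithinAt
  · exact (contDiffOn_const.mul contDiffOn_id).div
      (contDiffOn_const.add (contDiffOn_id.pow 2)) fun t _ => by positivity

theorem hardyWeight_nonneg {α κ t : ℝ} (hκ : 0 ≤ κ) (ht : 0 < t) : 0 ≤ hardyWeight α κ t := by
  unfold hardyWeight
  positivity

theorem deriv_hardyWeight (α κ : ℝ) {t : ℝ} (ht : 0 < t) :
    deriv (hardyWeight α κ) t = t ^ α * (α / t * (κ * t / (1 + t ^ 2)) +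
      κ * (1 - t ^ 2) / (1 + t ^ 2) ^ 2) := by
  have h1 : HasDerivAt (fun s : ℝ => s ^ α) (α * t ^ (α - 1)) t :=
    Real.hasDerivAt_rpow_const (Or.inl ht.ne')
  have h2 : HasDerivAt (fun s : ℝ => κ * s / (1 + s ^ 2))
      ((κ * 1 * (1 + t ^ 2) - κ * t * (0 + 2 * t)) / (1 + t ^ 2) ^ 2) t := by
    refine ((hasDerivAt_id t).const_mul κ).div ?_ (by positivity)
    simpa using ((hasDerivAt_id t).pow 2).const_add 1
  have h3 : HasDerivAt (hardyWeight α κ) _ t := h1.mul h2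
  rw [h3.deriv, Real.rpow_sub_one ht.ne']
  field_simp
  ring

/-- After division by `t ^ α` this is `(C + α) h / t + h' - h²` with `h = κ t / (1 + t²)`. The
numerator over `(1 + t²)²` is `κ ((κ + 1)(1 + t²) + 1 - t² - κ t²)`; the `t²` terms cancel, leaving
`κ (κ + 2)`. -/
theorem hardyWeight_riccati {C α κ t : ℝ} (hκ : κ = C + α - 1) (ht : 0 < t) :
    C / t * hardyWeight α κ t + deriv (hardyWeight α κ) t - t ^ α * (κ * t / (1 + t ^ 2)) ^ 2 =
      κ * (C + α + 1) * (t ^ α / (1 + t ^ 2) ^ 2) := by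
  obtain rfl : C = κ + 1 - α := by linarith
  rw [deriv_hardyWeight _ _ ht, hardyWeight]
  field_simp
  ring

/-- Expand `t ^ α * (Y - h |φ| N)² ≥ 0`. Here `X`, `Y`, `N` stand for `⟨∇ρ, ∇φ⟩`, `|∇φ|`, `|∇ρ|`. -/
theorem two_mul_hardyWeight_mul_le {α κ t φ X Y N : ℝ} (hκ : 0 ≤ κ) (ht : 0 < t)
    (hX : |X| ≤ N * Y) :
    -(2 * hardyWeight α κ t * φ * X) ≤
      t ^ α * Y ^ 2 + t ^ α * (κ * t / (1 + t ^ 2)) ^ 2 * φ ^ 2 * N ^ 2 := by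
  set T := t ^ α with hT
  set h := κ * t / (1 + t ^ 2) with hh
  have hT0 : 0 ≤ T := by positivity
  have hh0 : 0 ≤ h := by positivity
  have hF : hardyWeight α κ t = T * h := rfl
  have h1 : -(φ * X) ≤ |φ| * (N * Y) := by
    refine (neg_le_abs _).trans ?_
    rw [abs_mul]
    exact mul_le_mul_of_nonneg_left hX (abs_nonneg _)
  have h2 := mul_le_mul_of_nonneg_left h1 (mul_nonneg hT0 hh0)
  have h3 := mul_nonneg hT0 (sq_nonneg (Y - h * |φ| * N))
  rw [hF, ← sq_abs φ]
  nlinarith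

end Weight

/-! ### The affine Laplacian in weighted divergence form -/

section AffineInequality

variable {n : ℕ} {M : Type*} [TopologicalSpace M] [ChartedSpace (EuclideanSpace ℝ (Fin n)) M]

theorem contMDiff_exp_mul {u : M → ℝ} (hu : ContMDiff (𝓡 n) 𝓘(ℝ, ℝ) ∞ u) (c : ℝ) :
    ContMDiff (𝓡 n) 𝓘(ℝ, ℝ) ∞ fun x => Real.exp (u x * c) :=
  Real.contDiff_exp.contMDiff.comp (hu.mul contMDiff_const)

variable [RiemannianBundle (fun x : M => TangentSpace (𝓡 n) x)]

theorem grad_exp_mul {u : M → ℝ} (hu : ContMDiff (𝓡 n) 𝓘(ℝ, ℝ) ∞ u) (c : ℝ) (x : M) :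
    grad (n := n) (fun x => Real.exp (u x * c)) x = (c * Real.exp (u x * c)) • grad u x := by
  refine grad_comp (F := fun t => Real.exp (t * c)) ?_ (hu.mdifferentiableAt (by simp))
  have := ((hasDerivAt_id (u x)).mul_const c).exp
  simpa [mul_comm] using this

variable [IsManifold (𝓡 n) ∞ M] [IsContMDiffRiemannianBundle (𝓡 n) ∞ (EuclideanSpace ℝ (Fin n))
    (fun x : M => TangentSpace (𝓡 n) x)]
  [T2Space M] [SecondCountableTopology M] [Nonempty M] [MeasurableSpace M] [BorelSpace M]

/-- With `b = 2μ + nλ`, the factor `V^(b - (μ-λ))` turns the test function inside the distribution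
into `V^b η`. The term `b V^b η ∇u` of its gradient then cancels the drift term exactly. -/
theorem affineLaplacianDistrib_exp_mul {u ρ N : M → ℝ} (hu : ContMDiff (𝓡 n) 𝓘(ℝ, ℝ) ∞ u)
    (lam mu : ℝ) (hN : Continuous N) {G : ∀ x : M, TangentSpace (𝓡 n) x}
    (hG : IsWeakGradient ρ G) (hGN : ∀ᵐ x ∂riemannianVolume n M, ‖G x‖ = N x)
    {η : M → ℝ} (hη : ContMDiff (𝓡 n) 𝓘(ℝ, ℝ) ∞ η) (hηc : HasCompactSupport η) :
    affineLaplacianDistrib u lam mu G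
      (fun x => Real.exp (u x * (2 * mu + n * lam - (mu - lam))) * η x) =
      -∫ x, Real.exp (u x * (2 * mu + n * lam)) * inner ℝ (G x) (grad η x)
        ∂riemannianVolume n M := by
  set b := 2 * mu + n * lam with hb
  have hprod : ∀ x, Real.exp (u x) ^ (mu - lam) * (Real.exp (u x * (b - (mu - lam))) * η x) =
      Real.exp (u x * b) * η x := by
    intro x
    rw [← Real.exp_mul, ← mul_assoc, ← Real.exp_add]
    ring_nf
  simp only [affineLaplacianDistrib, laplacianDistrib, ← hb, hprod]
  have hg : ∀ x, (inner ℝ (G x) (grad (fun x => Real.exp (u x * b) * η x) x) : ℝ) =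
      Real.exp (u x * b) * inner ℝ (G x) (grad η x) +
        b * (Real.exp (u x * b) * η x) * inner ℝ (G x) (grad u x) := by
    intro x
    rw [grad_mul ((contMDiff_exp_mul hu b).mdifferentiableAt (by simp))
      (hη.mdifferentiableAt (by simp)), grad_exp_mul hu, inner_add_right,
      real_inner_smul_right, real_inner_smul_right, real_inner_smul_right]
    ring
  have hec := (contMDiff_exp_mul hu b).continuous
  have h1 : Integrable (fun x => Real.exp (u x * b) * (inner ℝ (G x) (grad η x) : ℝ))
      (riemannianVolume n M) :=
    integrable_mul_inner_grad hN hG hGN hη hηc hec.continuousOn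
      fun x hx => Or.inr (grad_eq_zero_of_notMem_tsupport hx)
  have h2 : Integrable (fun x => b * (Real.exp (u x * b) * η x) *
      (inner ℝ (G x) (grad u x) : ℝ)) (riemannianVolume n M) :=
    integrable_mul_inner_grad hN hG hGN hu hηc
      (continuous_const.mul (hec.mul hη.continuous)).continuousOn
      fun x hx => Or.inl (by simp [image_eq_zero_of_notMem_tsupport hx])
  have h3 : ∀ x, b * inner ℝ (grad u x) (G x) * (Real.exp (u x * b) * η x) =
      b * (Real.exp (u x * b) * η x) * (inner ℝ (G x) (grad u x) : ℝ) := by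
    intro x
    rw [real_inner_comm]
    ring
  simp only [hg, h3]
  rw [integral_add h1 h2]
  ring

end AffineInequality

end AffineHardy

end

/-! ### The Hardy inequality -/

open AffineHardy in
theorem mainTheorem11 {n : ℕ} {M : Type*} [TopologicalSpace M]
    [ChartedSpace (EuclideanSpace ℝ (Fin n)) M] [IsManifold (𝓡 n) ∞ M]
    [T2Space M] [SecondCountableTopology M] [Nonempty M]
    [MeasurableSpace M] [BorelSpace M]
    [RiemannianBundle (fun x : M => TangentSpace (𝓡 n) x)]
    [IsContMDiffRiemannianBundle (𝓡 n) ∞ (EuclideanSpace ℝ (Fin n))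
      (fun x : M => TangentSpace (𝓡 n) x)]
    (u : M → ℝ) (hu : ContMDiff (𝓡 n) 𝓘(ℝ, ℝ) ∞ u)
    (lam mu τ : ℝ) (hτ : τ = (n + 1) * lam + mu)
    (C α : ℝ) (hC : 1 < C) (hCα : 0 < C + α - 1)
    (ρ : M → ℝ) (hρ_cont : Continuous ρ) (hρ_nonneg : ∀ x, 0 ≤ ρ x)
    (gradρ : ∀ x : M, TangentSpace (𝓡 n) x) (hgradρ : AffineHardy.IsWeakGradient ρ gradρ)
    (hρ_grad : ∀ᵐ x ∂(AffineHardy.riemannianVolume n M),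
      ‖AffineHardy.affineGrad u lam mu gradρ x‖ = 1)
    (hρ_laplacian : ∀ ψ : M → ℝ, ContMDiff (𝓡 n) 𝓘(ℝ, ℝ) ∞ ψ → HasCompactSupport ψ →
      tsupport ψ ⊆ (ρ ⁻¹' {0})ᶜ → (∀ x, 0 ≤ ψ x) →
      ∫ x, C / ρ x * Real.exp (u x) ^ (lam - mu) * ψ x ∂(AffineHardy.riemannianVolume n M) ≤
        AffineHardy.affineLaplacianDistrib u lam mu gradρ ψ)
    (φ : M → ℝ) (hφ : ContMDiff (𝓡 n) 𝓘(ℝ, ℝ) ∞ φ) (hφ_supp : HasCompactSupport φ)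
    (hφ_tsupp : tsupport φ ⊆ (ρ ⁻¹' {0})ᶜ) :
    (C + α - 1) * (C + α + 1) *
        ∫ x, ρ x ^ α * (|φ x| ^ 2 / (1 + ρ x ^ 2) ^ 2) * Real.exp (u x) ^ (τ + lam - mu)
          ∂(AffineHardy.riemannianVolume n M) ≤
      ∫ x, ρ x ^ α * ‖AffineHardy.affineGrad u lam mu (AffineHardy.grad (n := n) φ) x‖ ^ 2 *
          Real.exp (u x) ^ (τ + lam - mu) ∂(AffineHardy.riemannianVolume n M) := by
  have hpos : (ρ ⁻¹' {0})ᶜ = {x | 0 < ρ x} := by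
    ext x
    simpa using (hρ_nonneg x).lt_iff_ne'.symm
  rw [hpos] at hφ_tsupp
  set a := mu - lam with ha
  set b := 2 * mu + n * lam with hb
  have hexp : τ + lam - mu = b - 2 * a := by rw [hτ, hb, ha]; ring
  set N : M → ℝ := fun x => Real.exp (u x * -a) with hN
  set w : M → ℝ := fun x => Real.exp (u x * b) with hw
  set P : M → ℝ := fun x => Real.exp (u x * (b - 2 * a)) with hP
  set q : M → ℝ := fun x => C / ρ x * P x with hq
  have hNc : Continuous N := (contMDiff_exp_mul hu _).continuous
  have hwc : Continuous w := (contMDiff_exp_mul hu _).continuous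
  have hPc : Continuous P := (contMDiff_exp_mul hu _).continuous
  have hwN : ∀ x, w x * N x ^ 2 = P x := by
    intro x
    simp only [hw, hN, hP, sq]
    rw [← Real.exp_add, ← Real.exp_add]
    ring_nf
  have hqc : ContinuousOn q {x | 0 < ρ x} :=
    (continuousOn_const.div hρ_cont.continuousOn fun x hx => (ne_of_gt hx)).mul hPc.continuousOn
  have hGN : ∀ᵐ x ∂riemannianVolume n M, ‖gradρ x‖ = N x := by
    filter_upwards [hρ_grad] with x hx
    rw [affineGrad, norm_smul, ← Real.exp_mul, Real.norm_eq_abs, Real.abs_exp] at hx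
    simp only [hN, mul_neg, Real.exp_neg]
    exact eq_inv_of_mul_eq_one_right hx
  have H : ∀ η : M → ℝ, ContMDiff (𝓡 n) 𝓘(ℝ, ℝ) ∞ η → HasCompactSupport η →
      tsupport η ⊆ {x | 0 < ρ x} → (∀ x, 0 ≤ η x) →
      ∫ x, q x * η x ∂riemannianVolume n M ≤
        -∫ x, w x * inner ℝ (gradρ x) (grad η x) ∂riemannianVolume n M := by
    intro η hη hηc hηρ hη0
    -- On the left, `V^(λ-μ) V^(b-a) = V^(b-2a)` is the weight `P`.
    have h := hρ_laplacian (fun x => Real.exp (u x * (b - a)) * η x)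
      ((contMDiff_exp_mul hu _).mul hη) hηc.mul_left
      ((closure_mono (Function.support_mul_subset_right _ η)).trans (hηρ.trans hpos.ge))
      fun x => mul_nonneg (Real.exp_pos _).le (hη0 x)
    rw [affineLaplacianDistrib_exp_mul hu lam mu hNc hgradρ hGN hη hηc] at h
    refine le_trans (le_of_eq (integral_congr_ae (ae_of_all _ fun x => ?_))) h
    simp only [hq, hP]
    rw [← Real.exp_mul, show u x * (b - 2 * a) = u x * (lam - mu) + u x * (b - a) by
      rw [ha]; ring, Real.exp_add]
    ring
  obtain ⟨κ, hκ⟩ : ∃ κ, κ = C + α - 1 := ⟨_, rfl⟩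
  rw [← hκ] at hCα ⊢
  have hφ2 : ContMDiff (𝓡 n) 𝓘(ℝ, ℝ) ∞ fun x => φ x * φ x := hφ.mul hφ
  have hφ2c : HasCompactSupport fun x => φ x * φ x := hφ_supp.mul_left
  have hφ2ρ : tsupport (fun x => φ x * φ x) ⊆ {x | 0 < ρ x} :=
    (closure_mono (Function.support_mul_subset_right φ φ)).trans hφ_tsupp
  have hF := contDiffOn_hardyWeight α κ
  -- The test function is formally `F(ρ) φ²`; the square makes it nonnegative whatever the sign of
  -- `φ`.
  have main := laplacian_inequality_comp hρ_cont hNc hwc hqc hgradρ hGN H hF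
    (fun t ht => hardyWeight_nonneg hCα.le ht) hφ2 hφ2c hφ2ρ
    fun x => mul_self_nonneg _
  have hIR := integrable_comp_gradient_terms hρ_cont hNc hwc hgradρ hGN hF hφ2 hφ2c hφ2ρ
  have hρα : ContinuousOn (fun x => ρ x ^ α) (tsupport φ) :=
    hρ_cont.continuousOn.rpow_const fun x hx => Or.inl (ne_of_gt (hφ_tsupp hx))
  have hIL : Integrable (fun x => q x * (hardyWeight α κ (ρ x) * (φ x * φ x)))
      (riemannianVolume n M) :=
    integrable_of_continuousOn_compact hφ_supp ((hqc.mono hφ_tsupp).mul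
      ((hF.continuousOn.comp hρ_cont.continuousOn hφ_tsupp).mul
        (hφ.continuous.mul hφ.continuous).continuousOn))
      fun x hx => by simp [image_eq_zero_of_notMem_tsupport hx]
  have hIA : Integrable (fun x => ρ x ^ α * (|φ x| ^ 2 / (1 + ρ x ^ 2) ^ 2) * P x)
      (riemannianVolume n M) :=
    integrable_of_continuousOn_compact hφ_supp ((hρα.mul ((hφ.continuous.abs.pow 2).div
      ((continuous_const.add (hρ_cont.pow 2)).pow 2) fun x =>
      (by positivity : ((1 : ℝ) + ρ x ^ 2) ^ 2 ≠ 0)).continuousOn).mul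
        hPc.continuousOn)
      fun x hx => by simp [image_eq_zero_of_notMem_tsupport hx]
  have hIB : Integrable (fun x => ρ x ^ α * ‖grad (n := n) φ x‖ ^ 2 * w x)
      (riemannianVolume n M) :=
    integrable_of_continuousOn_compact hφ_supp ((hρα.mul
      ((continuous_norm_grad hφ).pow 2).continuousOn).mul hwc.continuousOn)
      fun x hx => by simp [grad_eq_zero_of_notMem_tsupport hx]
  have hA : ∀ x, ρ x ^ α * (|φ x| ^ 2 / (1 + ρ x ^ 2) ^ 2) * Real.exp (u x) ^ (τ + lam - mu) =
      ρ x ^ α * (|φ x| ^ 2 / (1 + ρ x ^ 2) ^ 2) * P x := by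
    intro x
    rw [hexp, ← Real.exp_mul]
  have hB : ∀ x, ρ x ^ α * ‖affineGrad u lam mu (grad (n := n) φ) x‖ ^ 2 *
      Real.exp (u x) ^ (τ + lam - mu) = ρ x ^ α * ‖grad (n := n) φ x‖ ^ 2 * w x := by
    intro x
    have h1 : w x = Real.exp (u x * a) ^ 2 * P x := by
      simp only [hw, hP, sq]
      rw [← Real.exp_add, ← Real.exp_add]
      ring_nf
    rw [hexp, ← Real.exp_mul, affineGrad, norm_smul, ← Real.exp_mul, Real.norm_eq_abs,
      Real.abs_exp, h1]
    ring
  simp only [hA, hB]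
  rw [← integral_const_mul]
  -- Young's inequality and the Riccati identity, integrated; terms are placed so that `main`
  -- cancels the two integrals containing the radial weight.
  have hle : ∫ x, κ * (C + α + 1) *
        (ρ x ^ α * (|φ x| ^ 2 / (1 + ρ x ^ 2) ^ 2) * P x) ∂riemannianVolume n M +
      ∫ x, -(w x * (hardyWeight α κ (ρ x) * inner ℝ (gradρ x) (grad (fun x => φ x * φ x) x) +
        deriv (hardyWeight α κ) (ρ x) * (φ x * φ x) * ‖gradρ x‖ ^ 2)) ∂riemannianVolume n M ≤
      ∫ x, ρ x ^ α * ‖grad (n := n) φ x‖ ^ 2 * w x ∂riemannianVolume n M +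
      ∫ x, q x * (hardyWeight α κ (ρ x) * (φ x * φ x)) ∂riemannianVolume n M := by
    have hIRn : Integrable (fun x => -(w x * (hardyWeight α κ (ρ x) *
        inner ℝ (gradρ x) (grad (fun x => φ x * φ x) x) +
        deriv (hardyWeight α κ) (ρ x) * (φ x * φ x) * ‖gradρ x‖ ^ 2)))
        (riemannianVolume n M) := hIR.neg
    rw [← integral_add (hIA.const_mul _) hIRn, ← integral_add hIB hIL]
    refine integral_mono_ae ((hIA.const_mul _).add hIRn) (hIB.add hIL) ?_
    filter_upwards [hGN] with x hx
    by_cases hxS : x ∈ tsupport φ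
    · have hρx : 0 < ρ x := hφ_tsupp hxS
      have hφd := hφ.mdifferentiableAt (x := x) (by simp)
      rw [grad_mul hφd hφd, inner_add_right, real_inner_smul_right, hx]
      have h1 := two_mul_hardyWeight_mul_le (α := α) (φ := φ x) hCα.le hρx
        ((abs_real_inner_le_norm (gradρ x) (grad φ x)).trans_eq (by rw [hx]))
      have h2 : _ ≤ _ * w x := mul_le_mul_of_nonneg_right h1 (Real.exp_pos (u x * b)).le
      have h3 := hardyWeight_riccati hκ hρx
      rw [sq_abs]
      simp only [hq]
      -- Young's inequality times `w`, minus the Riccati identity times `φ² P`; `hwN` turns `w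
      -- |∇ρ|²` into `P` in the terms with `F'` and `ρ^α h²`.
      linear_combination h2 - (φ x ^ 2 * P x) * h3 - (deriv (hardyWeight α κ) (ρ x) -
        ρ x ^ α * (κ * ρ x / (1 + ρ x ^ 2)) ^ 2) * φ x ^ 2 * hwN x
    · have h0 : φ x = 0 := image_eq_zero_of_notMem_tsupport hxS
      have hg0 : grad (n := n) (fun x => φ x * φ x) x = 0 :=
        grad_eq_zero_of_notMem_tsupport fun h =>
          hxS (closure_mono (Function.support_mul_subset_right φ φ) h)
      simp [h0, hg0, grad_eq_zero_of_notMem_tsupport hxS]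
  rw [integral_neg] at hle
  linarith
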